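/- Let $G$ be a finite subgroup of $\mathrm{GL}_3(\mathbb{Q})$, acting on the rational function field $\mathbb{Q}(x_1,x_2,x_3)$ by $\mathbb{Q}$-automorphisms determined by $\sigma\cdot x_j=\sum_{i=1}^{3}a_{ij}x_i$ for $\sigma=(a_{ij})\in G$. Then the fixed field $\mathbb{Q}(x_1,x_2,x_3)^G=\{f\in\mathbb{Q}(x_1,x_2,x_3) : \sigma\cdot f=f \text{ for all } \sigma\in G\}$ is rational over $\mathbb{Q}$, i.e. it is generated over $\mathbb{Q}$ by finitely many elements that are algebraically independent over $\mathbb{Q}$. -/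

import Mathlib

noncomputable section

/-- The rational function field `k(x₀, …, x_{n-1})`. -/
abbrev RatFuncField (k : Type*) [Field k] (n : ℕ) : Type _ :=
  FractionRing (MvPolynomial (Fin n) k)

/-- The substitution `x_j ↦ ∑ i, a i j * x_i` on `k[x₀, …, x_{n-1}]` given by a matrix `a`. -/
def linearSubst {k : Type*} [Field k] {n : ℕ} (a : Matrix (Fin n) (Fin n) k) :
    MvPolynomial (Fin n) k →ₐ[k] MvPolynomial (Fin n) k :=
  MvPolynomial.aeval fun j => ∑ i, MvPolynomial.C (a i j) * MvPolynomial.X i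

theorem linearSubst_X {k : Type*} [Field k] {n : ℕ} (a : Matrix (Fin n) (Fin n) k) (j : Fin n) :
    linearSubst a (MvPolynomial.X j) = ∑ i, MvPolynomial.C (a i j) * MvPolynomial.X i := by
  simp [linearSubst]

theorem linearSubst_one {k : Type*} [Field k] {n : ℕ} :
    linearSubst (1 : Matrix (Fin n) (Fin n) k) = AlgHom.id k _ := by
  ext1 j
  rw [linearSubst_X, Finset.sum_eq_single j]
  · simp
  · intro i _ hij
    simp [Matrix.one_apply_ne hij]
  · simp

theorem linearSubst_mul {k : Type*} [Field k] {n : ℕ} (a b : Matrix (Fin n) (Fin n) k) :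
    linearSubst (a * b) = (linearSubst a).comp (linearSubst b) := by
  ext1 j
  rw [AlgHom.comp_apply, linearSubst_X, linearSubst_X, map_sum]
  simp only [map_mul, linearSubst_X, Matrix.mul_apply, map_sum, Finset.sum_mul, Finset.mul_sum,
    ← MvPolynomial.algebraMap_eq, AlgHom.commutes]
  rw [Finset.sum_comm]
  refine Finset.sum_congr rfl fun i _ => Finset.sum_congr rfl fun l _ => ?_
  ring

/-- The action of `GL_n(k)` on `k[x₀, …, x_{n-1}]` by `σ · x_j = ∑ i, σ i j * x_i`. -/
def linearActionPoly (k : Type*) [Field k] (n : ℕ) :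
    Matrix.GeneralLinearGroup (Fin n) k →*
      (MvPolynomial (Fin n) k ≃ₐ[k] MvPolynomial (Fin n) k) where
  toFun σ := AlgEquiv.ofAlgHom (linearSubst σ.1) (linearSubst σ⁻¹.1)
    (by rw [← linearSubst_mul, ← Units.val_mul, mul_inv_cancel, Units.val_one, linearSubst_one])
    (by rw [← linearSubst_mul, ← Units.val_mul, inv_mul_cancel, Units.val_one, linearSubst_one])
  map_one' := by
    ext1 f
    exact DFunLike.congr_fun linearSubst_one f
  map_mul' σ τ := by
    ext1 f
    exact DFunLike.congr_fun (linearSubst_mul σ.1 τ.1) f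

/-- The action of `GL_n(k)` on `k(x₀, …, x_{n-1})` by `k`-automorphisms with
`σ · x_j = ∑ i, σ i j * x_i`. -/
def linearAction (k : Type*) [Field k] (n : ℕ) :
    Matrix.GeneralLinearGroup (Fin n) k →* (RatFuncField k n ≃ₐ[k] RatFuncField k n) :=
  (IsFractionRing.fieldEquivOfAlgEquivHom k (RatFuncField k n)).comp (linearActionPoly k n)

theorem linearAction_X {k : Type*} [Field k] {n : ℕ} (σ : Matrix.GeneralLinearGroup (Fin n) k)
    (j : Fin n) :
    linearAction k n σ (algebraMap (MvPolynomial (Fin n) k) (RatFuncField k n)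
        (MvPolynomial.X j)) =
      ∑ i, algebraMap k (RatFuncField k n) (σ.1 i j) *
        algebraMap (MvPolynomial (Fin n) k) (RatFuncField k n) (MvPolynomial.X i) := by
  have h : linearActionPoly k n σ (MvPolynomial.X j) =
      ∑ i, MvPolynomial.C (σ.1 i j) * MvPolynomial.X i := linearSubst_X σ.1 j
  simp only [linearAction, MonoidHom.comp_apply, IsFractionRing.fieldEquivOfAlgEquivHom_apply,
    IsFractionRing.fieldEquivOfAlgEquiv_algebraMap, h, map_sum, map_mul,
    ← MvPolynomial.algebraMap_eq, ← IsScalarTower.algebraMap_apply]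

/-- The fixed field `k(x₀, …, x_{n-1})^G` of a subgroup `G` of `GL_n(k)`. -/
def linearFixedField {k : Type*} [Field k] {n : ℕ}
    (G : Subgroup (Matrix.GeneralLinearGroup (Fin n) k)) :
    IntermediateField k (RatFuncField k n) :=
  IntermediateField.fixedField (G.map (linearAction k n))

theorem mem_linearFixedField {k : Type*} [Field k] {n : ℕ}
    (G : Subgroup (Matrix.GeneralLinearGroup (Fin n) k)) (f : RatFuncField k n) :
    f ∈ linearFixedField G ↔ ∀ σ ∈ G, linearAction k n σ f = f := by
  simp [linearFixedField, IntermediateField.mem_fixedField_iff]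

/-- An intermediate field `F` of `E / k` is rational over `k` if it is purely transcendental over
`k` of finite transcendence degree: `F = k(f₀, …, f_{m-1})` for finitely many elements that are
algebraically independent over `k`. The algebra structure is an implicit argument, read off from
`F`, so that for `k = ℚ` it is not replaced by the canonical `ℚ`-algebra structure on `E`. -/
def IsRationalOver {k E : Type*} [Field k] [Field E] {_ : Algebra k E}
    (F : IntermediateField k E) : Prop :=
  ∃ (m : ℕ) (f : Fin m → E),
    AlgebraicIndependent k f ∧ IntermediateField.adjoin k (Set.range f) = F

end

/-!
The fixed field is analysed along towers of invariant subfields. If a finite group preserves a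
subfield `L` and acts on a transcendental element `z` by `z ↦ a z + b` with `a, b ∈ L`, then the
fixed field of `L(z)` is generated over the fixed field of `L` by one transcendental element, namely
an invariant polynomial in `z` of minimal positive degree (`exists_sup_inf_fixedField_eq`). At the
bottom of the towers is a field `k(t)`, where Lüroth's theorem applies.

If the group preserves a plane of linear forms with basis `a, b`, the tower `k(a / b) ⊆ k(a, b) ⊆
k(x₀, x₁, x₂)` settles the matter (`isRationalOver_of_invariant_plane`).

Otherwise, after multiplication of the elements by their determinants `±1`, which changes neither
the invariant subspaces nor the action on the functions of degree zero, there is an irreducible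
finite group of rational rotations (an invariant line has an orthogonal invariant plane). Its traces
are integers between `-1` and `3`, and counting elements by their traces shows that the nontrivial
rotations of some given trace have at most three axes (`exists_trace_card_image_axis_le`). By
irreducibility these axes are three independent lines, which are permuted by the group, and the
group contains the half-turns about them (`exists_invariant_submodule_or_half_turns`). In
coordinates `X₀, X₁, X₂` along these lines, the half-turns reduce the invariants of degree zero to
functions of the ratios of the `X i ^ 2`. With suitable coefficients, the squares `Y i = b i * X i ^
2` are permuted by the group, and the elements `3 * Y i / (Y 0 + Y 1 + Y 2) - 1` have sum zero and
span a plane on which the group acts linearly. So the invariants of degree zero form a rational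
field, and one more step of the tower gives the whole fixed field (`isRationalOver_of_monomial`).
-/

/-! ### Purely transcendental extensions and fixed fields -/

section Field

open Polynomial IntermediateField

variable {k E : Type*} [Field k] [Field E] [Algebra k E]

theorem mem_sup_adjoin_simple_iff {L : IntermediateField k E} {z x : E} :
    x ∈ L ⊔ k⟮z⟯ ↔ ∃ p q : L[X], x = aeval z p / aeval z q := by
  rw [← restrictScalars_adjoin_eq_sup, mem_restrictScalars, mem_adjoin_simple_iff]

theorem aeval_mem_sup_adjoin_simple {L : IntermediateField k E} (z : E) (p : L[X]) :
    aeval z p ∈ L ⊔ k⟮z⟯ :=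
  mem_sup_adjoin_simple_iff.mpr ⟨p, 1, by simp⟩

/-- An automorphism that preserves `L` and sends `z` to `a z + b` acts on `L[z]` without raising
degrees. -/
theorem exists_aeval_eq_map_aeval {L : IntermediateField k E} {z : E} {σ : E ≃ₐ[k] E}
    (hL : ∀ x ∈ L, σ x ∈ L) (hz : ∃ a b : L, σ z = a * z + b) (p : L[X]) :
    ∃ p' : L[X], p'.natDegree ≤ p.natDegree ∧ σ (aeval z p) = aeval z p' := by
  obtain ⟨a, b, hab⟩ := hz
  let s : L →+* L := (σ.toRingEquiv.toRingHom.comp (algebraMap L E)).codRestrict L.toSubfield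
    fun x => hL x x.2
  have hs : (algebraMap L E).comp s = (σ : E →+* E).comp (algebraMap L E) := by ext; rfl
  refine ⟨(p.map s).comp (C a * X + C b), ?_, ?_⟩
  · refine natDegree_comp_le.trans ?_
    calc (p.map s).natDegree * (C a * X + C b).natDegree
        ≤ p.natDegree * 1 := Nat.mul_le_mul natDegree_map_le natDegree_linear_le
      _ = p.natDegree := mul_one _
  · rw [aeval_comp, aeval_def z p, aeval_def, eval₂_map, hs]
    have := hom_eval₂ p (algebraMap L E) (σ : E →+* E) z
    simp only [RingHom.coe_coe] at this
    rw [this, hab]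
    simp

theorem prod_smul_mem_fixedField (H : Subgroup (E ≃ₐ[k] E)) [Fintype H] (x : E) :
    ∏ σ : H, (σ : E ≃ₐ[k] E) x ∈ fixedField H := by
  rw [mem_fixedField_iff]
  intro τ hτ
  rw [map_prod]
  exact Fintype.prod_equiv (Equiv.mulLeft (⟨τ, hτ⟩ : H)) _ _ fun σ => rfl

/-- If a finite group of automorphisms preserves `L` and acts on a transcendental `z` by affine
substitutions over `L`, then the fixed field of `L(z)` is generated over the fixed field of `L` by
one element: an invariant polynomial in `z` of minimal positive degree. -/
theorem exists_sup_inf_fixedField_eq (H : Subgroup (E ≃ₐ[k] E)) [Finite H]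
    (L : IntermediateField k E) (z : E) (hz : Transcendental L z)
    (hL : ∀ σ ∈ H, ∀ x ∈ L, σ x ∈ L) (haff : ∀ σ ∈ H, ∃ a b : L, σ z = a * z + b) :
    ∃ f : E, Transcendental L f ∧
      (L ⊔ k⟮z⟯) ⊓ fixedField H = (L ⊓ fixedField H) ⊔ k⟮f⟯ := by
  classical
  have := Fintype.ofFinite H
  have hinj : Function.Injective (aeval z : L[X] → E) := transcendental_iff_injective.mp hz
  have hex : ∃ n : ℕ, ∃ p : L[X], p.natDegree = n ∧ n ≠ 0 ∧ aeval z p ∈ fixedField H := by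
    choose! a b hab using haff
    have hp : aeval z (∏ σ : H, (C (a σ) * X + C (b σ))) = ∏ σ : H, (σ : E ≃ₐ[k] E) z := by
      rw [map_prod]
      exact Finset.prod_congr rfl fun σ _ => by simp [hab σ σ.2]
    have ha : ∀ σ : H, a σ ≠ 0 := by
      intro σ h0
      have h1 : (σ : E ≃ₐ[k] E) z ∈ L := by rw [hab σ σ.2, h0]; simp
      have h2 : z ∈ L := by
        have := hL _ (H.inv_mem σ.2) _ h1
        rwa [← AlgEquiv.mul_apply, inv_mul_cancel, AlgEquiv.one_apply] at this
      exact hz (isAlgebraic_algebraMap (⟨z, h2⟩ : L))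
    refine ⟨_, ∏ σ : H, (C (a σ) * X + C (b σ)), rfl, ?_, hp ▸ prod_smul_mem_fixedField H z⟩
    rw [natDegree_prod]
    · simp [natDegree_linear (ha _)]
    · intro σ _ h0
      have := natDegree_linear (b := b σ) (ha σ)
      rw [h0] at this
      simp at this
  obtain ⟨f, hf, hf0, hfF⟩ := Nat.find_spec hex
  have hmin : ∀ p : L[X], p.natDegree < f.natDegree → aeval z p ∈ fixedField H →
      p.natDegree = 0 := fun p hp hpF => by
    by_contra h
    exact Nat.find_min hex (hf ▸ hp) ⟨p, rfl, h, hpF⟩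
  replace hf0 : f.natDegree ≠ 0 := hf ▸ hf0
  -- Division by `f` commutes with the action, so that invariant polynomials are polynomials in `f`.
  have hpoly : ∀ n : ℕ, ∀ p : L[X], p.natDegree ≤ n → aeval z p ∈ fixedField H →
      aeval z p ∈ (L ⊓ fixedField H) ⊔ k⟮aeval z f⟯ := by
    intro n
    induction n using Nat.strong_induction_on with
    | _ n ih =>
    intro p hpn hp
    by_cases h0 : p.natDegree = 0
    · rw [eq_C_of_natDegree_eq_zero h0] at hp ⊢
      rw [aeval_C] at hp ⊢
      exact (le_sup_left : _ ≤ (L ⊓ fixedField H) ⊔ k⟮aeval z f⟯)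
        (mem_inf.mpr ⟨(p.coeff 0).2, hp⟩)
    have hdiv : f * (p / f) + p % f = p := EuclideanDomain.div_add_mod p f
    have hr : (p % f).natDegree < f.natDegree := natDegree_mod_lt p hf0
    have hev : aeval z f * aeval z (p / f) + aeval z (p % f) = aeval z p := by
      rw [← map_mul, ← map_add, hdiv]
    have hinv : ∀ σ ∈ H, σ (aeval z (p / f)) = aeval z (p / f) := by
      intro σ hσ
      obtain ⟨q', -, hq'⟩ := exists_aeval_eq_map_aeval (hL σ hσ) (haff σ hσ) (p / f)
      obtain ⟨r', hr', hrr'⟩ := exists_aeval_eq_map_aeval (hL σ hσ) (haff σ hσ) (p % f)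
      have h1 : f * q' + r' = p := by
        apply hinj
        have h2 := congrArg σ hev
        rw [map_add, map_mul, (mem_fixedField_iff _ _).mp hfF σ hσ,
          (mem_fixedField_iff _ _).mp hp σ hσ, hq', hrr'] at h2
        rw [← h2]
        simp
      have h3 : f * (p / f - q') = r' - p % f := by linear_combination hdiv - h1
      have h4 : p / f - q' = 0 := by
        by_contra hne
        have hf1 : f ≠ 0 := fun h => hf0 (by simp [h])
        have h5 := congrArg natDegree h3
        rw [natDegree_mul hf1 hne] at h5
        have h6 := natDegree_sub_le r' (p % f)
        have := max_lt (hr'.trans_lt hr) hr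
        omega
      rw [hq', sub_eq_zero.mp h4]
    have hqF : aeval z (p / f) ∈ fixedField H := (mem_fixedField_iff _ _).mpr hinv
    have hrF : aeval z (p % f) ∈ fixedField H := by
      rw [← eq_sub_iff_add_eq'] at hev
      rw [hev]
      exact sub_mem hp (mul_mem hfF hqF)
    have hr0 := hmin _ hr hrF
    rw [← hev]
    refine add_mem (mul_mem ?_ ?_) ?_
    · exact (le_sup_right : _ ≤ (L ⊓ fixedField H) ⊔ k⟮aeval z f⟯) (mem_adjoin_simple_self k _)
    · refine ih (p / f).natDegree ?_ _ le_rfl hqF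
      by_cases hpf : p / f = 0
      · rw [hpf, natDegree_zero]
        omega
      · have hp0 : p ≠ 0 := fun h => h0 (by simp [h])
        exact (natDegree_lt_natDegree hpf (degree_div_lt hp0
          (natDegree_pos_iff_degree_pos.mp (Nat.pos_of_ne_zero hf0)))).trans_le hpn
    · rw [eq_C_of_natDegree_eq_zero hr0] at hrF ⊢
      rw [aeval_C] at hrF ⊢
      exact (le_sup_left : _ ≤ (L ⊓ fixedField H) ⊔ k⟮aeval z f⟯)
        (mem_inf.mpr ⟨((p % f).coeff 0).2, hrF⟩)
  refine ⟨aeval z f, hz.aeval f hf0 ?_, le_antisymm ?_ ?_⟩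
  · exact mem_nonZeroDivisors_of_ne_zero (leadingCoeff_ne_zero.mpr fun h => hf0 (by simp [h]))
  · rintro e ⟨heL, heF⟩
    obtain ⟨p, q, rfl⟩ := mem_sup_adjoin_simple_iff.mp heL
    by_cases hq : aeval z q = 0
    · simp [hq]
    -- Multiplying numerator and denominator by the conjugates of the denominator makes both
    -- invariant.
    choose! c hc1 hc2 using fun (σ : E ≃ₐ[k] E) (hσ : σ ∈ H) =>
      exists_aeval_eq_map_aeval (hL σ hσ) (haff σ hσ) q
    set Q : E := ∏ σ : H, (σ : E ≃ₐ[k] E) (aeval z q) with hQ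
    have hQF : Q ∈ fixedField H := prod_smul_mem_fixedField H _
    have hQ0 : Q ≠ 0 := Finset.prod_ne_zero_iff.mpr fun σ _ => by simpa using hq
    have hQp : Q = aeval z (∏ σ : H, c σ) := by
      rw [map_prod, hQ]
      exact Finset.prod_congr rfl fun σ _ => hc2 σ σ.2
    have hnum : aeval z p / aeval z q * Q
        = aeval z (p * ∏ σ ∈ Finset.univ.erase (1 : H), c σ) := by
      rw [hQ, ← Finset.mul_prod_erase _ _ (Finset.mem_univ (1 : H)), map_mul, map_prod]
      have : ∏ σ ∈ Finset.univ.erase (1 : H), (σ : E ≃ₐ[k] E) (aeval z q)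
          = ∏ σ ∈ Finset.univ.erase (1 : H), aeval z (c σ) :=
        Finset.prod_congr rfl fun σ _ => hc2 σ σ.2
      rw [this]
      simp only [OneMemClass.coe_one, AlgEquiv.one_apply]
      field_simp
    have h1 := hpoly _ _ le_rfl (hQp ▸ hQF)
    have h2 := hpoly _ _ le_rfl (hnum ▸ mul_mem heF hQF)
    rw [← hQp] at h1
    rw [← hnum] at h2
    simpa [hQ0] using div_mem h2 h1
  · refine sup_le (inf_le_inf_right _ le_sup_left) ?_
    rw [adjoin_simple_le_iff]
    exact ⟨aeval_mem_sup_adjoin_simple z f, hfF⟩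

theorem IsRationalOver.sup_adjoin_simple {M L : IntermediateField k E} (hM : IsRationalOver M)
    (hML : M ≤ L) {f : E} (hf : Transcendental L f) : IsRationalOver (M ⊔ k⟮f⟯) := by
  obtain ⟨m, g, hg, rfl⟩ := hM
  have h1 : Transcendental (Algebra.adjoin k (Set.range g)) f := by
    have hle : Algebra.adjoin k (Set.range g) ≤ L.toSubalgebra :=
      (algebra_adjoin_le_adjoin k _).trans hML
    let _ := (Subalgebra.inclusion hle).toAlgebra
    have : IsScalarTower (Algebra.adjoin k (Set.range g)) L.toSubalgebra E :=
      IsScalarTower.of_algebraMap_eq fun x => rfl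
    have hinj : Function.Injective
        (algebraMap (Algebra.adjoin k (Set.range g)) L.toSubalgebra) :=
      Subalgebra.inclusion_injective hle
    exact Transcendental.restrictScalars (S := L.toSubalgebra) hinj hf
  have h2 := (hg.option_iff_transcendental f).mpr h1
  refine ⟨m + 1, (fun o : Option (Fin m) => o.elim f g) ∘ finSuccEquiv m,
    h2.comp _ (finSuccEquiv m).injective, ?_⟩
  rw [(finSuccEquiv m).surjective.range_comp, ← adjoin_union]
  congr 1
  ext x
  constructor
  · rintro ⟨_ | i, rfl⟩
    · exact Or.inr rfl
    · exact Or.inl ⟨i, rfl⟩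
  · rintro (⟨i, rfl⟩ | rfl)
    · exact ⟨some i, rfl⟩
    · exact ⟨none, rfl⟩

theorem IsRationalOver.sup_inf_fixedField (H : Subgroup (E ≃ₐ[k] E)) [Finite H]
    {L : IntermediateField k E} (h : IsRationalOver (L ⊓ fixedField H)) {z : E}
    (hz : Transcendental L z) (hL : ∀ σ ∈ H, ∀ x ∈ L, σ x ∈ L)
    (haff : ∀ σ ∈ H, ∃ a b : L, σ z = a * z + b) :
    IsRationalOver ((L ⊔ k⟮z⟯) ⊓ fixedField H) := by
  obtain ⟨f, hf, heq⟩ := exists_sup_inf_fixedField_eq H L z hz hL haff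
  rw [heq]
  exact h.sup_adjoin_simple inf_le_left hf

/-- Lüroth's theorem for the subfields of a simple transcendental extension inside `E`. -/
theorem isRationalOver_of_le_adjoin_simple {t : E} (ht : Transcendental k t)
    {M : IntermediateField k E} (hM : M ≤ k⟮t⟯) : IsRationalOver M := by
  let φ : RatFunc k →ₐ[k] E := k⟮t⟯.val.comp (RatFunc.algEquivOfTranscendental t ht).toAlgHom
  have hrange : k⟮t⟯ ≤ φ.fieldRange := by
    intro x hx
    obtain ⟨y, hy⟩ := (RatFunc.algEquivOfTranscendental t ht).surjective ⟨x, hx⟩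
    exact ⟨y, by simp [φ, hy]⟩
  have hmap : (M.comap φ).map φ = M := by
    ext x
    constructor
    · rintro ⟨y, hy, rfl⟩
      exact hy
    · intro hx
      obtain ⟨y, rfl⟩ := hrange (hM hx)
      exact ⟨y, hx, rfl⟩
  set N := M.comap φ with hN
  by_cases hbot : N = ⊥
  · rw [← hmap, hbot, IntermediateField.map_bot]
    exact ⟨0, Fin.elim0, algebraicIndependent_empty_type_iff.mpr (algebraMap k E).injective,
      by simp⟩
  · refine ⟨1, fun _ => φ (RatFunc.Luroth.generator N), ?_, ?_⟩
    · rw [algebraicIndependent_unique_type_iff]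
      rw [Transcendental, isAlgebraic_algHom_iff φ φ.injective]
      exact RatFunc.Luroth.transcendental_generator hbot
    · rw [Set.range_const, ← hmap]
      conv_rhs => rw [RatFunc.Luroth.eq_adjoin_generator (E := N), adjoin_map]
      simp

end Field

/-! ### Towers and invariant planes -/

section Field

open Polynomial IntermediateField

variable {k E : Type*} [Field k] [Field E] [Algebra k E]

theorem map_mem_of_mem_adjoin (σ : E ≃ₐ[k] E) {S : Set E} {L : IntermediateField k E}
    (h : ∀ x ∈ S, σ x ∈ L) : ∀ x ∈ adjoin k S, σ x ∈ L := fun _ hx =>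
  (adjoin_le_iff (T := L.comap (σ : E →ₐ[k] E))).mpr h hx

theorem adjoin_pair_eq_sup (x y : E) : adjoin k {x, y} = k⟮x⟯ ⊔ k⟮y⟯ := by
  rw [Set.insert_eq, adjoin_union]

/-- In transcendence degree `n`, any `n` elements over which `E` is algebraic are algebraically
independent. -/
theorem algebraicIndependent_of_trdeg_eq (n : ℕ) (htr : Algebra.trdeg k E = n) (t : Fin n → E)
    (halg : ∀ L : IntermediateField k E, (∀ i, t i ∈ L) → Algebra.IsAlgebraic L E) :
    AlgebraicIndependent k t := by
  have h1 : Algebra.IsAlgebraic (adjoin k (Set.range t)) E :=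
    halg _ fun i => subset_adjoin k _ ⟨i, rfl⟩
  have h2 : Algebra.IsAlgebraic (Algebra.adjoin k (Set.range t)) E := by
    open scoped algebraAdjoinAdjoin in
    exact (IsFractionRing.comap_isAlgebraic_iff (A := Algebra.adjoin k (Set.range t))
      (K := adjoin k (Set.range t))).mpr h1
  exact (Algebra.IsAlgebraic.isTranscendenceBasis_of_lift_le_trdeg_of_finite k t (by simp [htr])).1

theorem AlgebraicIndependent.transcendental_intermediateField_adjoin {ι : Type*} {t : ι → E}
    (h : AlgebraicIndependent k t) {s : Set ι} {i : ι} (hi : i ∉ s) :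
    Transcendental (adjoin k (t '' s)) (t i) := by
  open scoped algebraAdjoinAdjoin in
  exact fun halg => h.transcendental_adjoin hi
    ((IsFractionRing.isAlgebraic_iff (Algebra.adjoin k (t '' s)) (adjoin k (t '' s)) E).mpr halg)

theorem AlgebraicIndependent.transcendental_tower {x y z : E}
    (h : AlgebraicIndependent k ![x, y, z]) :
    Transcendental k x ∧ Transcendental k⟮x⟯ y ∧
      Transcendental (k⟮x⟯ ⊔ k⟮y⟯ : IntermediateField k E) z := by
  refine ⟨h.transcendental 0, ?_, ?_⟩
  · have := h.transcendental_intermediateField_adjoin (s := {0}) (i := 1) (by simp)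
    rwa [Set.image_singleton] at this
  · have := h.transcendental_intermediateField_adjoin (s := {0, 1}) (i := 2) (by simp)
    rwa [Set.image_pair, adjoin_pair_eq_sup] at this

/-- The invariants of a finite group acting linearly on the plane spanned by `p` and `q`: the group
acts on `p / q` by Möbius transformations, so that Lüroth's theorem applies to `k(p / q)`, and it
multiplies `q` by elements of `k(p / q)`. -/
theorem isRationalOver_plane (H : Subgroup (E ≃ₐ[k] E)) [Finite H] {p q : E}
    (ht : Transcendental k (p / q)) (hq : Transcendental k⟮p / q⟯ q)
    (hlin : ∀ σ ∈ H, ∃ a b c d : k, σ p = a • p + b • q ∧ σ q = c • p + d • q) :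
    IsRationalOver ((k⟮p / q⟯ ⊔ k⟮q⟯) ⊓ fixedField H) := by
  have hq0 : q ≠ 0 := fun h => hq (h ▸ isAlgebraic_zero)
  have hmem : ∀ a b : k, a • (p / q) + b • 1 ∈ k⟮p / q⟯ := fun a b =>
    add_mem (IntermediateField.smul_mem _ (mem_adjoin_simple_self k _))
      (IntermediateField.smul_mem _ (one_mem _))
  have hfrac : ∀ a b : k, a • p + b • q = (a • (p / q) + b • 1) * q := fun a b => by
    simp only [Algebra.smul_def]
    field_simp
  refine (isRationalOver_of_le_adjoin_simple ht inf_le_left).sup_inf_fixedField H hq ?_ ?_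
  · intro σ hσ
    refine map_mem_of_mem_adjoin σ ?_
    rintro _ rfl
    obtain ⟨a, b, c, d, hp, hq'⟩ := hlin σ hσ
    rw [map_div₀, hp, hq', hfrac, hfrac, mul_div_mul_right _ _ hq0]
    exact div_mem (hmem a b) (hmem c d)
  · intro σ hσ
    obtain ⟨a, b, c, d, -, hq'⟩ := hlin σ hσ
    exact ⟨⟨_, hmem c d⟩, 0, by simp [hq', hfrac]⟩

theorem plane_stable {σ : E ≃ₐ[k] E} {p q : E} (hq0 : q ≠ 0)
    (hlin : ∃ a b c d : k, σ p = a • p + b • q ∧ σ q = c • p + d • q) :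
    p ∈ k⟮p / q⟯ ⊔ k⟮q⟯ ∧ q ∈ k⟮p / q⟯ ⊔ k⟮q⟯ ∧
      ∀ x ∈ k⟮p / q⟯ ⊔ k⟮q⟯, σ x ∈ k⟮p / q⟯ ⊔ k⟮q⟯ := by
  have hq : q ∈ k⟮p / q⟯ ⊔ k⟮q⟯ :=
    (le_sup_right : k⟮q⟯ ≤ k⟮p / q⟯ ⊔ k⟮q⟯) (mem_adjoin_simple_self k q)
  have hp : p ∈ k⟮p / q⟯ ⊔ k⟮q⟯ := by
    have := mul_mem ((le_sup_left : k⟮p / q⟯ ≤ k⟮p / q⟯ ⊔ k⟮q⟯) (mem_adjoin_simple_self k _)) hq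
    rwa [div_mul_cancel₀ _ hq0] at this
  refine ⟨hp, hq, ?_⟩
  have heq : k⟮p / q⟯ ⊔ k⟮q⟯ = adjoin k {p / q, q} := (adjoin_pair_eq_sup _ _).symm
  obtain ⟨a, b, c, d, h1, h2⟩ := hlin
  have hσp : σ p ∈ k⟮p / q⟯ ⊔ k⟮q⟯ := h1 ▸ add_mem (IntermediateField.smul_mem _ hp)
    (IntermediateField.smul_mem _ hq)
  have hσq : σ q ∈ k⟮p / q⟯ ⊔ k⟮q⟯ := h2 ▸ add_mem (IntermediateField.smul_mem _ hp)
    (IntermediateField.smul_mem _ hq)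
  rw [heq] at hσp hσq ⊢
  refine map_mem_of_mem_adjoin σ ?_
  rintro _ (rfl | rfl)
  · rw [map_div₀]
    exact div_mem hσp hσq
  · exact hσq

/-- The rationality of the fixed field when the plane spanned by `a` and `b` and the space spanned by
`a`, `b` and `c` are invariant: the tower is `k(a / b) ⊆ k(a, b) ⊆ k(a, b, c)`. -/
theorem isRationalOver_of_invariant_plane (htr : Algebra.trdeg k E = (3 : ℕ))
    (H : Subgroup (E ≃ₐ[k] E)) [Finite H] {a b c : E} (hgen : adjoin k {a, b, c} = ⊤)
    (hb : b ≠ 0)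
    (hlin : ∀ σ ∈ H, ∃ α β γ δ : k, σ a = α • a + β • b ∧ σ b = γ • a + δ • b)
    (haff : ∀ σ ∈ H, ∃ α β χ : k, σ c = χ • c + (α • a + β • b)) :
    IsRationalOver (fixedField H) := by
  obtain ⟨ha', hb', -⟩ := plane_stable (σ := (1 : E ≃ₐ[k] E)) hb (hlin 1 H.one_mem)
  have hle : ⊤ ≤ (k⟮a / b⟯ ⊔ k⟮b⟯) ⊔ k⟮c⟯ := by
    rw [← hgen, adjoin_le_iff]
    rintro _ (rfl | rfl | rfl)
    · exact (le_sup_left : _ ≤ (k⟮_ / b⟯ ⊔ k⟮b⟯) ⊔ k⟮c⟯) ha'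
    · exact (le_sup_left : _ ≤ (k⟮a / _⟯ ⊔ k⟮_⟯) ⊔ k⟮c⟯) hb'
    · exact (le_sup_right : _ ≤ (k⟮a / b⟯ ⊔ k⟮b⟯) ⊔ k⟮_⟯) (mem_adjoin_simple_self k _)
  have hind : AlgebraicIndependent k ![a / b, b, c] := by
    refine algebraicIndependent_of_trdeg_eq 3 htr _ fun L hL => ?_
    have hL' : L = ⊤ := by
      rw [eq_top_iff]
      refine hle.trans (sup_le (sup_le ?_ ?_) ?_) <;> rw [adjoin_simple_le_iff]
      exacts [hL 0, hL 1, hL 2]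
    exact ⟨fun x => isAlgebraic_algebraMap (⟨x, hL' ▸ mem_top⟩ : L)⟩
  obtain ⟨h0, h1, h2⟩ := hind.transcendental_tower
  have key := (isRationalOver_plane H h0 h1 hlin).sup_inf_fixedField H h2
    (fun σ hσ => (plane_stable hb (hlin σ hσ)).2.2) (by
      intro σ hσ
      obtain ⟨α, β, χ, h⟩ := haff σ hσ
      refine ⟨⟨algebraMap k E χ, IntermediateField.algebraMap_mem _ _⟩, ⟨α • a + β • b,
        add_mem (IntermediateField.smul_mem _ ha') (IntermediateField.smul_mem _ hb')⟩, ?_⟩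
      simp [h, Algebra.smul_def])
  rwa [top_le_iff.mp hle, top_inf_eq] at key

/-- An element of `M(z)` with `z ^ 2 ∈ M` that is fixed by an automorphism over `M` with
`z ↦ -z` lies in `M`. -/
theorem mem_of_mem_sup_of_map_neg [CharZero k] {M : IntermediateField k E} {z x : E}
    (hz : z ^ 2 ∈ M) (σ : E ≃ₐ[k] E) (hM : ∀ y ∈ M, σ y = y) (hσz : σ z = -z)
    (hx : x ∈ M ⊔ k⟮z⟯) (hσx : σ x = x) : x ∈ M := by
  have : CharZero E := charZero_of_injective_algebraMap (algebraMap k E).injective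
  have hint : IsIntegral M z := ⟨X ^ 2 - C ⟨z ^ 2, hz⟩, monic_X_pow_sub_C _ two_ne_zero, by simp⟩
  rw [← restrictScalars_adjoin_eq_sup, mem_restrictScalars, ← mem_toSubalgebra,
    adjoin_simple_toSubalgebra_of_isAlgebraic hint.isAlgebraic,
    Algebra.adjoin_singleton_eq_range_aeval] at hx
  obtain ⟨p, rfl⟩ := hx
  set m : M[X] := X ^ 2 - C ⟨z ^ 2, hz⟩ with hm
  have hmm : m.Monic := monic_X_pow_sub_C _ two_ne_zero
  have hev : aeval z p = aeval z (p %ₘ m) := by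
    conv_lhs => rw [← modByMonic_add_div p m]
    simp [hm]
  have hdeg : (p %ₘ m).natDegree ≤ 1 := by
    have h1 := natDegree_modByMonic_lt p hmm (by
      intro h
      have := natDegree_X_pow_sub_C (n := 2) (r := (⟨z ^ 2, hz⟩ : M))
      rw [← hm, h] at this
      simp at this)
    rw [show m.natDegree = 2 from natDegree_X_pow_sub_C] at h1
    omega
  obtain ⟨a, b, hab⟩ := exists_eq_X_add_C_of_natDegree_le_one hdeg
  change σ (aeval z p) = aeval z p at hσx
  change aeval z p ∈ M
  rw [hev, hab] at hσx ⊢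
  simp only [map_add, map_mul, aeval_C, aeval_X, hσz] at hσx ⊢
  have ha : σ (algebraMap M E a) = algebraMap M E a := hM _ a.2
  have hb : σ (algebraMap M E b) = algebraMap M E b := hM _ b.2
  rw [ha, hb] at hσx
  have : algebraMap M E a * z = 0 := by linear_combination (-1 / 2 : E) * hσx
  rw [this, zero_add]
  exact b.2

end Field

/-! ### Monomial actions -/

section Field

open IntermediateField

variable {k E : Type*} [Field k] [Field E] [Algebra k E]

theorem map_eq_self_of_mem_adjoin (σ : E ≃ₐ[k] E) {S : Set E} (h : ∀ x ∈ S, σ x = x) :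
    ∀ x ∈ adjoin k S, σ x = x := fun _ hx => by
  induction hx using adjoin_induction with
  | mem x hx => exact h x hx
  | algebraMap x => exact σ.commutes x
  | add x y _ _ hx hy => rw [map_add, hx, hy]
  | inv x _ hx => rw [map_inv₀, hx]
  | mul x y _ _ hx hy => rw [map_mul, hx, hy]

theorem AlgebraicIndependent.aeval_ne_zero {ι : Type*} {t : ι → E} (h : AlgebraicIndependent k t)
    (P : MvPolynomial ι k) {v : ι → k} (hv : MvPolynomial.eval v P ≠ 0) :
    MvPolynomial.aeval t P ≠ 0 := by
  intro h0
  have : P = 0 := h (by rw [h0, map_zero])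
  simp [this] at hv

/-- The fixed field of a finite group acting on `k(X₀, X₁, X₂)` by monomial substitutions that
permute three multiples `b i * X i ^ 2` of the squares of the variables, when the group contains,
up to scalars, the three diagonal half-turns.

The half-turns reduce the invariants of degree zero to functions of the ratios of the
`b i * X i ^ 2`. Normalised by their invariant sum these three elements span, after a translation,
a plane on which the group acts linearly. -/
theorem isRationalOver_of_monomial [CharZero k] (htr : Algebra.trdeg k E = (3 : ℕ))
    (H : Subgroup (E ≃ₐ[k] E)) [Finite H] (X : Fin 3 → E) (hgen : adjoin k (Set.range X) = ⊤)
    (b : Fin 3 → k) (hb : ∀ i, b i ≠ 0)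
    (hperm : ∀ σ ∈ H, ∃ π : Equiv.Perm (Fin 3), ∃ ε : Fin 3 → k, (∀ i, σ (X i) = ε i • X (π i)) ∧
      ∀ i, σ (b i • X i ^ 2) = b (π i) • X (π i) ^ 2)
    (hflip : ∀ i, ∃ σ ∈ H, ∃ s : k, s ^ 2 = 1 ∧ ∀ j, σ (X j) = (if j = i then s else -s) • X j) :
    IsRationalOver (fixedField H) := by
  have : CharZero E := charZero_of_injective_algebraMap (algebraMap k E).injective
  have hX : AlgebraicIndependent k X := by
    refine algebraicIndependent_of_trdeg_eq 3 htr X fun L hL => ?_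
    have hL' : L = ⊤ := by
      rw [eq_top_iff, ← hgen, adjoin_le_iff]
      rintro _ ⟨i, rfl⟩
      exact hL i
    exact ⟨fun x => isAlgebraic_algebraMap (⟨x, hL' ▸ mem_top⟩ : L)⟩
  have hX0 : ∀ i, X i ≠ 0 := hX.ne_zero
  set Y : Fin 3 → E := fun i => b i • X i ^ 2 with hY
  set S : E := ∑ i, Y i with hS
  have hS0 : S ≠ 0 := by
    have := hX.aeval_ne_zero (∑ i, MvPolynomial.C (b i) * MvPolynomial.X i ^ 2)
      (v := Pi.single 0 1) (by simp [Fin.sum_univ_three, hb])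
    simpa [hS, hY, Algebra.smul_def] using this
  set P : Fin 3 → E := fun i => 3 * Y i / S - 1 with hP
  have hPY : ∀ i, P i + 1 = 3 * Y i / S := fun i => by simp [hP]
  have hPsum : P 0 + P 1 + P 2 = 0 := by
    have : Y 0 + Y 1 + Y 2 = S := by rw [hS, Fin.sum_univ_three]
    simp only [hP]
    field_simp
    linear_combination 3 * this
  have hP1 : P 1 ≠ 0 := by
    have := hX.aeval_ne_zero
      (3 * (MvPolynomial.C (b 1) * MvPolynomial.X 1 ^ 2) -
        ∑ i, MvPolynomial.C (b i) * MvPolynomial.X i ^ 2)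
      (v := Pi.single 1 1) (by
        simp only [map_sub, map_mul, map_pow, map_ofNat, MvPolynomial.eval_C,
          MvPolynomial.eval_X, Fin.sum_univ_three]
        simp only [Pi.single_apply]
        have h2 : (2 : k) * b 1 ≠ 0 := mul_ne_zero two_ne_zero (hb 1)
        intro h
        apply h2
        simp at h
        linear_combination h)
    intro h
    apply this
    have h3 : 3 * Y 1 - S = P 1 * S := by
      simp only [hP]
      field_simp
    rw [h, zero_mul] at h3
    simpa [hS, hY, Algebra.smul_def] using h3
  have hPspan : ∀ i, ∃ α β : k, P i = α • P 0 + β • P 1 := by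
    intro i
    fin_cases i
    · exact ⟨1, 0, by simp⟩
    · exact ⟨0, 1, by simp⟩
    · refine ⟨-1, -1, ?_⟩
      simp only [neg_smul, one_smul, Fin.reduceFinMk]
      linear_combination hPsum
  have hσY : ∀ σ ∈ H, ∃ π : Equiv.Perm (Fin 3), ∀ i, σ (P i) = P (π i) := by
    intro σ hσ
    obtain ⟨π, -, -, hπ⟩ := hperm σ hσ
    have hσS : σ S = S := by
      rw [hS, map_sum]
      exact Fintype.sum_equiv π _ _ hπ
    refine ⟨π, fun i => ?_⟩
    simp only [hP, map_sub, map_div₀, map_mul, map_one, map_ofNat, hσS]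
    rw [show σ (Y i) = Y (π i) from hπ i]
  have hlin : ∀ σ ∈ H, ∃ α β γ δ : k,
      σ (P 0) = α • P 0 + β • P 1 ∧ σ (P 1) = γ • P 0 + δ • P 1 := by
    intro σ hσ
    obtain ⟨π, hπ⟩ := hσY σ hσ
    obtain ⟨α, β, h1⟩ := hPspan (π 0)
    obtain ⟨γ, δ, h2⟩ := hPspan (π 1)
    exact ⟨α, β, γ, δ, (hπ 0).trans h1, (hπ 1).trans h2⟩
  set M : IntermediateField k E := k⟮P 0 / P 1⟯ ⊔ k⟮P 1⟯ with hM
  obtain ⟨hM0, hM1, -⟩ := plane_stable (σ := (1 : E ≃ₐ[k] E)) hP1 (hlin 1 H.one_mem)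
  have hPmem : ∀ L : IntermediateField k E, P 0 ∈ L → P 1 ∈ L → ∀ i, Y i / S ∈ L := by
    intro L h0 h1 i
    obtain ⟨α, β, h⟩ := hPspan i
    have h2 : P i ∈ L := h ▸ add_mem (IntermediateField.smul_mem _ h0)
      (IntermediateField.smul_mem _ h1)
    have h3 : Y i / S = (P i + 1) / 3 := by rw [hPY]; ring
    rw [h3]
    exact div_mem (add_mem h2 (one_mem _)) (ofNat_mem L 3)
  -- The squares of the ratios of the variables lie in `M`.
  have hsq : ∀ i j, (X i / X j) ^ 2 ∈ M := by
    intro i j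
    have h1 := div_mem (hPmem M hM0 hM1 i) (hPmem M hM0 hM1 j)
    have h2 : (X i / X j) ^ 2 = (b j / b i) • (Y i / S / (Y j / S)) := by
      have hbE : ∀ l, algebraMap k E (b l) ≠ 0 := fun l => by simpa using hb l
      have := hX0 j
      have := hbE i
      have := hbE j
      simp only [hY, Algebra.smul_def, map_div₀]
      field_simp
    rw [h2]
    exact IntermediateField.smul_mem _ h1
  have hindM : AlgebraicIndependent k ![P 0 / P 1, P 1, X 2] := by
    refine algebraicIndependent_of_trdeg_eq 3 htr _ fun L hL => ?_
    have hML : M ≤ L := by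
      rw [hM, sup_le_iff, adjoin_simple_le_iff, adjoin_simple_le_iff]
      exact ⟨hL 0, hL 1⟩
    have hXL : ∀ i, X i ^ 2 ∈ L := fun i => by
      have h1 : X i ^ 2 = (X i / X 2) ^ 2 * X 2 ^ 2 := by
        have := hX0 2
        field_simp
      rw [h1]
      exact mul_mem (hML (hsq i 2)) (pow_mem (hL 2) 2)
    have hle : (⊤ : IntermediateField k E) ≤
        (algebraicClosure L E).restrictScalars k := by
      rw [← hgen, adjoin_le_iff]
      rintro _ ⟨i, rfl⟩
      change X i ∈ algebraicClosure L E
      rw [mem_algebraicClosure_iff]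
      exact ((isAlgebraic_algebraMap (⟨_, hXL i⟩ : L) : IsAlgebraic L (X i ^ 2))).of_pow two_pos
    exact ⟨fun x => mem_algebraicClosure_iff.mp (hle (mem_top : x ∈ ⊤))⟩
  obtain ⟨h0, h1, -⟩ := hindM.transcendental_tower
  have hrat : IsRationalOver (M ⊓ fixedField H) := isRationalOver_plane H h0 h1 hlin
  set K : IntermediateField k E := k⟮X 0 / X 2⟯ ⊔ k⟮X 1 / X 2⟯ with hK
  have hKX : ∀ i, X i / X 2 ∈ K := by
    intro i
    fin_cases i
    · exact (le_sup_left : _ ≤ K) (mem_adjoin_simple_self k _)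
    · exact (le_sup_right : _ ≤ K) (mem_adjoin_simple_self k _)
    · have : X 2 / X 2 ∈ K := by rw [div_self (hX0 2)]; exact one_mem _
      exact this
  have hle : ⊤ ≤ K ⊔ k⟮X 2⟯ := by
    rw [← hgen, adjoin_le_iff]
    rintro _ ⟨i, rfl⟩
    have := mul_mem ((le_sup_left : K ≤ K ⊔ k⟮X 2⟯) (hKX i))
      ((le_sup_right : k⟮X 2⟯ ≤ K ⊔ k⟮X 2⟯) (mem_adjoin_simple_self k _))
    rwa [div_mul_cancel₀ _ (hX0 2)] at this
  have hindK : AlgebraicIndependent k ![X 0 / X 2, X 1 / X 2, X 2] := by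
    refine algebraicIndependent_of_trdeg_eq 3 htr _ fun L hL => ?_
    have hL' : L = ⊤ := by
      rw [eq_top_iff]
      refine hle.trans (sup_le (sup_le ?_ ?_) ?_) <;> rw [adjoin_simple_le_iff]
      exacts [hL 0, hL 1, hL 2]
    exact ⟨fun x => isAlgebraic_algebraMap (⟨x, hL' ▸ mem_top⟩ : L)⟩
  have hPK : ∀ i, P i ∈ K := by
    have hYK : ∀ i, Y i / X 2 ^ 2 ∈ K := fun i => by
      have : Y i / X 2 ^ 2 = b i • (X i / X 2) ^ 2 := by
        simp only [hY, Algebra.smul_def]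
        field_simp
      rw [this]
      exact IntermediateField.smul_mem _ (pow_mem (hKX i) 2)
    intro i
    have : P i = 3 * (Y i / X 2 ^ 2) / (∑ j, Y j / X 2 ^ 2) - 1 := by
      rw [← Finset.sum_div, ← hS]
      have := hX0 2
      simp only [hP]
      field_simp
    rw [this]
    exact sub_mem (div_mem (mul_mem (ofNat_mem K 3) (hYK i)) (sum_mem fun j _ => hYK j))
      (one_mem _)
  have hMK : M ≤ K := by
    rw [hM, sup_le_iff, adjoin_simple_le_iff, adjoin_simple_le_iff]
    exact ⟨div_mem (hPK 0) (hPK 1), hPK 1⟩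
  -- Each half-turn changes the sign of one of `X 0 / X 2` and `X 1 / X 2` and fixes `M` and the
  -- other one.
  have hKM : K ⊓ fixedField H = M ⊓ fixedField H := by
    refine le_antisymm ?_ (inf_le_inf_right _ hMK)
    rintro x ⟨hxK, hxF⟩
    refine ⟨?_, hxF⟩
    have hfix : ∀ i, ∀ σ : E ≃ₐ[k] E, ∀ s : k, s ^ 2 = 1 →
        (∀ j, σ (X j) = (if j = i then s else -s) • X j) → ∀ y ∈ M, σ y = y := by
      intro i σ s hs hσX
      have hYσ : ∀ j, σ (Y j) = Y j := fun j => by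
        have : (if j = i then s else -s) ^ 2 = 1 := by split_ifs <;> simp [hs]
        simp only [hY]
        rw [Algebra.smul_def, map_mul, AlgEquiv.commutes, map_pow, hσX, smul_pow, this, one_smul]
      have hPσ : ∀ j, σ (P j) = P j := fun j => by
        simp only [hP, hS, map_sub, map_div₀, map_mul, map_ofNat, map_one, map_sum, hYσ]
      rw [hM, ← adjoin_pair_eq_sup]
      refine map_eq_self_of_mem_adjoin σ ?_
      rintro _ (rfl | rfl)
      · rw [map_div₀, hPσ, hPσ]
      · exact hPσ 1
    obtain ⟨σ₀, hσ₀, s₀, hs₀, h₀⟩ := hflip 0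
    obtain ⟨σ₁, hσ₁, s₁, hs₁, h₁⟩ := hflip 1
    have hs₀' : algebraMap k E s₀ ≠ 0 := by
      rw [_root_.map_ne_zero]
      rintro rfl
      simp at hs₀
    have hs₁' : algebraMap k E s₁ ≠ 0 := by
      rw [_root_.map_ne_zero]
      rintro rfl
      simp at hs₁
    have hX2 := hX0 2
    have hxM : x ∈ M ⊔ k⟮X 1 / X 2⟯ := by
      refine mem_of_mem_sup_of_map_neg (z := X 0 / X 2) 
        ((le_sup_left : M ≤ M ⊔ k⟮X 1 / X 2⟯) (hsq 0 2)) σ₀ ?_ ?_ ?_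
        ((mem_fixedField_iff _ _).mp hxF σ₀ hσ₀)
      · have h01 : σ₀ (X 1 / X 2) = X 1 / X 2 := by
          rw [map_div₀, h₀ 1, h₀ 2]
          simp [Algebra.smul_def]
          field_simp
        have h0M := hfix 0 σ₀ s₀ hs₀ h₀
        have hM' : M = adjoin k (M : Set E) := (adjoin_self k M).symm
        rw [hM', ← adjoin_union]
        refine map_eq_self_of_mem_adjoin σ₀ ?_
        rintro y (hy | rfl)
        exacts [h0M y hy, h01]
      · rw [map_div₀, h₀ 0, h₀ 2]
        simp [Algebra.smul_def]
        field_simp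
      · exact (sup_le (le_sup_right) (le_sup_right.trans le_sup_left) : K ≤ _) hxK
    refine mem_of_mem_sup_of_map_neg (hsq 1 2) σ₁ (hfix 1 σ₁ s₁ hs₁ h₁) ?_ hxM
      ((mem_fixedField_iff _ _).mp hxF σ₁ hσ₁)
    rw [map_div₀, h₁ 1, h₁ 2]
    simp [Algebra.smul_def]
    field_simp
  obtain ⟨-, -, h2⟩ := hindK.transcendental_tower
  have key := (hKM ▸ hrat : IsRationalOver (K ⊓ fixedField H)).sup_inf_fixedField H h2 (by
      intro σ hσ
      obtain ⟨π, ε, hε, -⟩ := hperm σ hσ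
      have hmem : ∀ i, σ (X i / X 2) ∈ K := fun i => by
        have h : σ (X i / X 2)
            = (algebraMap k E (ε i) / algebraMap k E (ε 2)) * (X (π i) / X 2 / (X (π 2) / X 2)) := by
          have := hX0 2
          rw [map_div₀, hε, hε, Algebra.smul_def, Algebra.smul_def,
            div_div_div_cancel_right₀ this, mul_div_mul_comm]
        rw [h]
        exact mul_mem (div_mem (IntermediateField.algebraMap_mem _ _)
          (IntermediateField.algebraMap_mem _ _)) (div_mem (hKX _) (hKX _))
      rw [hK, ← adjoin_pair_eq_sup]
      refine map_mem_of_mem_adjoin σ ?_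
      rw [adjoin_pair_eq_sup]
      rintro _ (rfl | rfl)
      exacts [hmem 0, hmem 1]) (by
      intro σ hσ
      obtain ⟨π, ε, hε, -⟩ := hperm σ hσ
      refine ⟨⟨ε 2 • (X (π 2) / X 2), IntermediateField.smul_mem _ (hKX _)⟩, 0, ?_⟩
      have := hX0 2
      rw [hε]
      simp [Algebra.smul_def]
      field_simp)
  rwa [top_le_iff.mp hle, top_inf_eq] at key

end Field

/-! ### Rational matrices of finite order -/

section FiniteOrder

open Matrix

theorem pow_mulVec_eq_of_mulVec_eq {K n : Type*} [Field K] [Fintype n] [DecidableEq n]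
    {A : Matrix n n K} {x : K} {v : n → K} (h : A *ᵥ v = x • v) (m : ℕ) :
    (A ^ m) *ᵥ v = x ^ m • v := by
  induction m with
  | zero => simp
  | succ m ih => rw [pow_succ, ← mulVec_mulVec, h, mulVec_smul, ih, smul_smul, pow_succ']

theorem pow_eq_one_of_mulVec_eq {K n : Type*} [Field K] [Fintype n] [DecidableEq n]
    {A : Matrix n n K} {m : ℕ} (hA : A ^ m = 1) {x : K} {v : n → K} (hv : v ≠ 0)
    (h : A *ᵥ v = x • v) : x ^ m = 1 := by
  have h1 := pow_mulVec_eq_of_mulVec_eq h m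
  rw [hA, one_mulVec] at h1
  have h2 : (x ^ m - 1) • v = 0 := by rw [sub_smul, one_smul, ← h1, sub_self]
  simpa [hv, sub_eq_zero] using h2

theorem pow_eq_one_of_det_eq_zero {K n : Type*} [Field K] [Fintype n] [DecidableEq n]
    {A : Matrix n n K} {m : ℕ} (hA : A ^ m = 1) {x : K} (h : (x • 1 - A).det = 0) :
    x ^ m = 1 := by
  obtain ⟨v, hv, hxv⟩ := exists_mulVec_eq_zero_iff.mpr h
  refine pow_eq_one_of_mulVec_eq hA hv ?_
  rw [sub_mulVec, smul_mulVec, one_mulVec, sub_eq_zero] at hxv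
  exact hxv.symm

/-- The trace of a rational matrix of finite order is a sum of roots of unity, hence an integer. -/
theorem exists_intCast_eq_trace {n : Type*} [Fintype n] [DecidableEq n] {A : Matrix n n ℚ} {m : ℕ}
    (hm : m ≠ 0) (hA : A ^ m = 1) : ∃ t : ℤ, (t : ℚ) = A.trace := by
  have hint : IsIntegral ℤ (algebraMap ℚ ℂ A.trace) := by
    have htr : algebraMap ℚ ℂ A.trace = (A.map (algebraMap ℚ ℂ)).trace := by simp [trace]
    rw [htr, trace_eq_sum_roots_charpoly]
    refine IsIntegral.multiset_sum fun x hx => ?_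
    rw [Polynomial.mem_roots (charpoly_monic _).ne_zero, Polynomial.IsRoot.def,
      eval_charpoly] at hx
    have hA' : (A.map (algebraMap ℚ ℂ)) ^ m = 1 := by
      rw [← Matrix.map_pow, hA, Matrix.map_one _ (map_zero _) (map_one _)]
    have hx1 : x ^ m = 1 := by
      refine pow_eq_one_of_det_eq_zero hA' ?_
      rwa [smul_one_eq_diagonal, ← scalar_apply]
    exact ⟨Polynomial.X ^ m - 1, Polynomial.monic_X_pow_sub_C 1 hm, by simp [hx1]⟩
  rw [isIntegral_algebraMap_iff (algebraMap ℚ ℂ).injective] at hint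
  obtain ⟨t, ht⟩ := IsIntegrallyClosed.isIntegral_iff.mp hint
  exact ⟨t, by simpa using ht⟩

/-- A unipotent element `1 + N` of finite order is trivial in characteristic zero: modulo `N ^ 2` its
`m`-th power is `1 + m N`. -/
theorem eq_zero_of_pow_three_eq_zero_of_pow_eq_one {R : Type*} [Ring R] [Algebra ℚ R] {N : R}
    (hN : N ^ 3 = 0) {m : ℕ} (hm : m ≠ 0) (h : (1 + N) ^ m = 1) : N = 0 := by
  have hpow : ∀ j : ℕ, ∃ c : ℚ, (1 + N) ^ j = 1 + (j : ℚ) • N + c • N ^ 2 := by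
    intro j
    induction j with
    | zero => exact ⟨0, by simp⟩
    | succ j ih =>
      obtain ⟨c, hc⟩ := ih
      refine ⟨c + j, ?_⟩
      have h3 : N ^ 2 * N = 0 := by rw [← pow_succ, hN]
      rw [pow_succ, hc]
      simp only [add_mul, mul_add, mul_one, one_mul, smul_mul_assoc, h3, smul_zero, add_zero,
        ← sq, add_smul, Nat.cast_add, Nat.cast_one, one_smul]
      abel
  obtain ⟨c, hc⟩ := hpow m
  have hm' : (m : ℚ) ≠ 0 := by exact_mod_cast hm
  have h1 : (m : ℚ) • N + c • N ^ 2 = 0 := by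
    rw [h, add_assoc] at hc
    simpa using hc.symm
  have h2 : N ^ 2 = 0 := by
    have := congrArg (· * N) h1
    simp only [add_mul, smul_mul_assoc, ← sq, ← pow_succ, hN, smul_zero, add_zero, zero_mul] at this
    simpa [hm'] using this
  simpa [h2, hm'] using h1

theorem det_smul_one_sub_fin_three {R : Type*} [CommRing R] (A : Matrix (Fin 3) (Fin 3) R) (x : R) :
    (x • 1 - A).det = x ^ 3 - A.trace * x ^ 2 + A.adjugate.trace * x - A.det := by
  simp [adjugate_fin_three, det_fin_three, trace_fin_three]
  ring

theorem trace_sq_fin_three {R : Type*} [CommRing R] (A : Matrix (Fin 3) (Fin 3) R) :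
    (A ^ 2).trace = A.trace ^ 2 - 2 * A.adjugate.trace := by
  simp [adjugate_fin_three, trace_fin_three, sq, Matrix.mul_apply, Fin.sum_univ_three]
  ring

/-- The Cayley-Hamilton theorem in dimension three. -/
theorem pow_three_fin_three {R : Type*} [CommRing R] (A : Matrix (Fin 3) (Fin 3) R) :
    A ^ 3 = A.trace • A ^ 2 - A.adjugate.trace • A + A.det • 1 := by
  ext i j
  fin_cases i <;> fin_cases j <;>
  · simp [adjugate_fin_three, det_fin_three, trace_fin_three, pow_succ, Matrix.mul_apply,
      Fin.sum_univ_three]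
    ring

/-- A rational matrix of finite order in `SL₃` with eigenvalue `1` has the further eigenvalues
`λ, λ⁻¹` on the unit circle, and so has trace `1 + λ + λ⁻¹ ∈ [-1, 3]`. -/
theorem trace_mem_of_pow_eq_one {A : Matrix (Fin 3) (Fin 3) ℚ} {m : ℕ} (hm : m ≠ 0)
    (hA : A ^ m = 1) (hdet : A.det = 1) (h1 : A.adjugate.trace = A.trace) :
    -1 ≤ A.trace ∧ A.trace ≤ 3 := by
  set s : ℝ := (A.trace : ℝ) - 1 with hs
  have key : s ^ 2 ≤ 4 := by
    by_contra! h
    set r := √(s ^ 2 - 4) with hr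
    have hr2 : r ^ 2 = s ^ 2 - 4 := Real.sq_sqrt (by linarith)
    set x := (s + r) / 2 with hx
    have hxs : x ^ 2 - s * x + 1 = 0 := by rw [hx]; linear_combination hr2 / 4
    have hA' : (A.map (algebraMap ℚ ℝ)) ^ m = 1 := by
      rw [← Matrix.map_pow, hA, Matrix.map_one _ (map_zero _) (map_one _)]
    have hx1 : x ^ m = 1 := by
      refine pow_eq_one_of_det_eq_zero hA' ?_
      rw [det_smul_one_sub_fin_three]
      have e1 : (A.map (algebraMap ℚ ℝ)).trace = (A.trace : ℝ) := by
        simp [trace_fin_three]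
      have e2 : (A.map (algebraMap ℚ ℝ)).adjugate.trace = (A.adjugate.trace : ℝ) := by
        simp [trace_fin_three, adjugate_fin_three]
      have e3 : (A.map (algebraMap ℚ ℝ)).det = (A.det : ℝ) := by
        simp [det_fin_three]
      rw [e1, e2, e3, h1, hdet, show (A.trace : ℝ) = s + 1 by rw [hs]; ring]
      push_cast
      linear_combination (x - 1) * hxs
    have hx2 : x ^ 2 = 1 := by
      have : |x| = 1 := by
        have := congrArg abs hx1
        rw [abs_pow, abs_one] at this
        exact (pow_eq_one_iff_of_nonneg (abs_nonneg x) hm).mp this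
      rw [← sq_abs, this, one_pow]
    nlinarith
  have h2 := abs_le.mp (abs_le_of_sq_le_sq (a := s) (b := 2) (by linarith) (by norm_num))
  constructor
  · have : (-1 : ℝ) ≤ A.trace := by linarith [h2.1]
    exact_mod_cast this
  · have : (A.trace : ℝ) ≤ 3 := by linarith [h2.2]
    exact_mod_cast this

end FiniteOrder

/-! ### Finite rotation groups -/

section Rotation

open Matrix

theorem exists_smul_of_cross_eq_zero {K : Type*} [Field K] {x y : Fin 3 → K} (hx : x ≠ 0)
    (h : x ⨯₃ y = 0) : ∃ c : K, y = c • x := by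
  obtain ⟨j, hj⟩ := Function.ne_iff.mp hx
  have h0 := congrFun h 0
  have h1 := congrFun h 1
  have h2 := congrFun h 2
  simp only [cross_apply, cons_val, Pi.zero_apply] at h0 h1 h2 hj
  refine ⟨y j / x j, ?_⟩
  ext i
  rw [Pi.smul_apply, smul_eq_mul, div_mul_eq_mul_div, eq_div_iff hj]
  fin_cases i <;> fin_cases j <;> simp only [Fin.zero_eta, Fin.mk_one, Fin.reduceFinMk] <;>
    first
    | ring1
    | linear_combination h0
    | linear_combination h1
    | linear_combination h2
    | linear_combination -h0
    | linear_combination -h1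
    | linear_combination -h2

/-- A rotation of finite order other than the identity fixes only one line pointwise: otherwise
`A - 1` is a matrix `a φᵀ` of rank one, and it is nilpotent as `det A = 1 + φ ⬝ a`. -/
theorem exists_smul_of_mulVec_eq_self {A : Matrix (Fin 3) (Fin 3) ℚ} {m : ℕ} (hm : m ≠ 0)
    (hA : A ^ m = 1) (hdet : A.det = 1) (hne : A ≠ 1) {v w : Fin 3 → ℚ} (hv0 : v ≠ 0)
    (hv : A *ᵥ v = v) (hw : A *ᵥ w = w) : ∃ c : ℚ, w = c • v := by
  by_cases hφ : v ⨯₃ w = 0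
  · exact exists_smul_of_cross_eq_zero hv0 hφ
  exfalso
  set φ := v ⨯₃ w with hφdef
  set N := A - 1 with hN
  have hNv : N *ᵥ v = 0 := by rw [hN, sub_mulVec, one_mulVec, hv, sub_self]
  have hNw : N *ᵥ w = 0 := by rw [hN, sub_mulVec, one_mulVec, hw, sub_self]
  have hrow : ∀ i, ∃ a : ℚ, N i = a • φ := by
    intro i
    apply exists_smul_of_cross_eq_zero hφ
    have h1 : N i 0 * v 0 + N i 1 * v 1 + N i 2 * v 2 = 0 := by
      have := congrFun hNv i
      rwa [mulVec, dotProduct, Fin.sum_univ_three] at this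
    have h2 : N i 0 * w 0 + N i 1 * w 1 + N i 2 * w 2 = 0 := by
      have := congrFun hNw i
      rwa [mulVec, dotProduct, Fin.sum_univ_three] at this
    rw [hφdef]
    ext j
    fin_cases j <;> simp [cross_apply]
    · linear_combination w 0 * h1 - v 0 * h2
    · linear_combination w 1 * h1 - v 1 * h2
    · linear_combination w 2 * h1 - v 2 * h2
  choose a ha using hrow
  have hNa : N = vecMulVec a φ := by
    ext i j
    rw [ha i]
    rfl
  have hA1 : A = 1 + N := by rw [hN]; abel
  have htr : φ ⬝ᵥ a = 0 := by
    rw [hA1, hNa] at hdet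
    simp [det_fin_three, vecMulVec_apply] at hdet
    simp [dotProduct, Fin.sum_univ_three]
    linear_combination hdet
  have hN2 : N ^ 2 = 0 := by
    rw [sq, hNa, vecMulVec_mul_vecMulVec, htr]
    simp
  have := eq_zero_of_pow_three_eq_zero_of_pow_eq_one (N := N) (by rw [pow_succ, hN2, zero_mul]) hm
    (by rw [← hA1, hA])
  exact hne (by rw [hA1, this, add_zero])

variable {Γ : Type*} [Group Γ] [Fintype Γ] (ρ : Γ →* Matrix (Fin 3) (Fin 3) ℚ)

/-- The Gram matrix of the sum of the translates of the standard scalar product. -/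
def invariantForm : Matrix (Fin 3) (Fin 3) ℚ := ∑ h, (ρ h)ᵀ * ρ h

theorem transpose_mul_invariantForm_mul (g : Γ) :
    (ρ g)ᵀ * invariantForm ρ * ρ g = invariantForm ρ := by
  rw [invariantForm, Finset.mul_sum, Finset.sum_mul]
  refine Fintype.sum_equiv (Equiv.mulRight g) _ _ fun h => ?_
  simp [transpose_mul, Matrix.mul_assoc]

theorem dotProduct_invariantForm (v w : Fin 3 → ℚ) :
    v ⬝ᵥ (invariantForm ρ *ᵥ w) = ∑ h, (ρ h *ᵥ v) ⬝ᵥ (ρ h *ᵥ w) := by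
  rw [invariantForm, sum_mulVec, dotProduct_sum]
  refine Finset.sum_congr rfl fun h _ => ?_
  rw [← mulVec_mulVec, dotProduct_mulVec, vecMul_transpose]

theorem dotProduct_invariantForm_self_ne_zero {v : Fin 3 → ℚ} (hv : v ≠ 0) :
    v ⬝ᵥ (invariantForm ρ *ᵥ v) ≠ 0 := by
  rw [dotProduct_invariantForm]
  refine (Finset.sum_pos' (fun h _ => ?_) ⟨1, Finset.mem_univ _, ?_⟩).ne'
  · exact Finset.sum_nonneg fun i _ => mul_self_nonneg _
  · rw [map_one, one_mulVec]
    exact lt_of_le_of_ne (Finset.sum_nonneg fun i _ => mul_self_nonneg _)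
      (Ne.symm (mt dotProduct_self_eq_zero.mp hv))

theorem dotProduct_invariantForm_map (g : Γ) (v w : Fin 3 → ℚ) :
    (ρ g *ᵥ v) ⬝ᵥ (invariantForm ρ *ᵥ (ρ g *ᵥ w)) = v ⬝ᵥ (invariantForm ρ *ᵥ w) := by
  conv_rhs => rw [← transpose_mul_invariantForm_mul ρ g]
  rw [← mulVec_mulVec, ← mulVec_mulVec, dotProduct_mulVec v, vecMul_transpose]

theorem det_invariantForm_ne_zero : (invariantForm ρ).det ≠ 0 := by
  intro h
  obtain ⟨v, hv, h0⟩ := exists_mulVec_eq_zero_iff.mpr h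
  exact dotProduct_invariantForm_self_ne_zero ρ hv (by rw [h0, dotProduct_zero])

variable {ρ}

theorem map_pow_card_eq_one (g : Γ) : ρ g ^ Fintype.card Γ = 1 := by
  rw [← map_pow, pow_card_eq_one, map_one]

variable (hdet : ∀ g, (ρ g).det = 1)
include hdet

/-- Euler's theorem: an element of a finite group of matrices of determinant one in dimension three
fixes a vector. It is similar to its inverse transpose by the invariant form. -/
theorem det_one_sub_eq_zero (g : Γ) : (1 - ρ g).det = 0 := by
  have hinv : ρ g * ρ g⁻¹ = 1 := by rw [← map_mul, mul_inv_cancel, map_one]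
  have h1 : (1 - (ρ g)ᵀ) * invariantForm ρ = -(invariantForm ρ * (1 - ρ g) * ρ g⁻¹) := by
    have : (ρ g)ᵀ * invariantForm ρ = invariantForm ρ * ρ g⁻¹ := by
      rw [← mul_one ((ρ g)ᵀ * invariantForm ρ), ← hinv, ← mul_assoc,
        transpose_mul_invariantForm_mul]
    rw [sub_mul, this, mul_sub, sub_mul, mul_assoc _ (ρ g), hinv]
    simp
  have h2 := congrArg det h1
  rw [det_mul, det_neg, det_mul, det_mul, hdet, ← transpose_one, ← transpose_sub,
    det_transpose] at h2
  have h3 : (invariantForm ρ).det * (1 - ρ g).det = 0 := by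
    simp at h2
    linear_combination h2 / 2
  exact (mul_eq_zero.mp h3).resolve_left (det_invariantForm_ne_zero ρ)

/-- The characteristic polynomial vanishes at `1`, which equates its two middle coefficients. -/
theorem trace_adjugate_eq_trace (g : Γ) : (ρ g).adjugate.trace = (ρ g).trace := by
  have h1 := det_smul_one_sub_fin_three (ρ g) 1
  rw [one_smul, det_one_sub_eq_zero hdet, hdet] at h1
  linear_combination -h1

theorem trace_map_inv (g : Γ) : (ρ g⁻¹).trace = (ρ g).trace := by
  -- The adjugate of `ρ g` is its inverse.
  rw [← trace_adjugate_eq_trace hdet g]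
  congr 1
  have hinv : ρ g * ρ g⁻¹ = 1 := by rw [← map_mul, mul_inv_cancel, map_one]
  rw [← one_mul (ρ g⁻¹), ← one_smul ℚ (1 : Matrix (Fin 3) (Fin 3) ℚ), ← hdet g, ← adjugate_mul,
    mul_assoc, hinv, mul_one]

theorem exists_mulVec_eq_self (g : Γ) : ∃ v ≠ 0, ρ g *ᵥ v = v := by
  obtain ⟨v, hv, h⟩ := exists_mulVec_eq_zero_iff.mpr (det_one_sub_eq_zero hdet g)
  rw [sub_mulVec, one_mulVec, sub_eq_zero] at h
  exact ⟨v, hv, h.symm⟩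

theorem trace_mem (g : Γ) :
    ∃ t : ℤ, (t : ℚ) = (ρ g).trace ∧ t ∈ ({-1, 0, 1, 2, 3} : Finset ℤ) := by
  have hm : Fintype.card Γ ≠ 0 := Fintype.card_ne_zero
  obtain ⟨t, ht⟩ := exists_intCast_eq_trace hm (map_pow_card_eq_one (ρ := ρ) g)
  obtain ⟨h1, h2⟩ := trace_mem_of_pow_eq_one hm (map_pow_card_eq_one (ρ := ρ) g) (hdet g)
    (trace_adjugate_eq_trace hdet g)
  rw [← ht] at h1 h2
  refine ⟨t, ht, ?_⟩
  have h1' : -1 ≤ t := by exact_mod_cast h1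
  have h2' : t ≤ 3 := by exact_mod_cast h2
  simp only [Finset.mem_insert, Finset.mem_singleton]
  omega

theorem map_eq_one_of_trace_eq_three {g : Γ} (h : (ρ g).trace = 3) : ρ g = 1 := by
  have h1 := pow_three_fin_three (ρ g)
  rw [trace_adjugate_eq_trace hdet, h, hdet, one_smul] at h1
  have h2 : (ρ g - 1) ^ 3 = 0 := by
    have : (ρ g - 1) ^ 3 = ρ g ^ 3 - (3 : ℚ) • ρ g ^ 2 + (3 : ℚ) • ρ g - 1 := by
      simp only [ofNat_smul_eq_nsmul, pow_succ, pow_zero, one_mul, mul_sub, sub_mul, mul_one]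
      abel
    rw [this, h1]
    abel
  have h3 := eq_zero_of_pow_three_eq_zero_of_pow_eq_one h2 (Fintype.card_ne_zero (α := Γ))
    (by rw [add_sub_cancel, map_pow_card_eq_one])
  exact sub_eq_zero.mp h3

theorem trace_eq_of_mul_self_eq_one {g : Γ} (h : g * g = 1) :
    (ρ g).trace = -1 ∨ (ρ g).trace = 3 := by
  have h1 := trace_sq_fin_three (ρ g)
  rw [sq, ← map_mul, h, map_one, trace_adjugate_eq_trace hdet] at h1
  simp at h1
  have : ((ρ g).trace + 1) * ((ρ g).trace - 3) = 0 := by linear_combination -h1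
  rcases mul_eq_zero.mp this with h | h
  · left; linarith
  · right; linarith

end Rotation

/-! ### Counting axes -/

section Counting

open Matrix

theorem exists_sum_character_eq {Γ W : Type*} [Group Γ] [Fintype Γ] [AddCommGroup W] [Module ℚ W]
    [FiniteDimensional ℚ W] (σ : Representation ℚ Γ W) :
    ∑ g, σ.character g = Fintype.card Γ * Module.finrank ℚ σ.invariants := by
  have h0 : (Nat.card Γ : ℚ) ≠ 0 := by
    rw [Nat.card_eq_fintype_card]
    exact_mod_cast Fintype.card_ne_zero
  have : Invertible (Nat.card Γ : ℚ) := invertibleOfNonzero h0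
  have h := σ.card_inv_mul_sum_char_eq_finrank
  rw [inv_mul_eq_iff_eq_mul₀ h0, Nat.card_eq_fintype_card] at h
  exact h

/-- The sums of the positive powers of a character are divisible by the order of the group, as the
powers are the characters of the tensor powers. -/
theorem exists_sum_character_pow_eq {Γ W : Type*} [Group Γ] [Fintype Γ] [AddCommGroup W]
    [Module ℚ W] [FiniteDimensional ℚ W] (σ : Representation ℚ Γ W) (j : ℕ) :
    ∃ d : ℕ, ∑ g, σ.character g ^ (j + 1) = Fintype.card Γ * d := by
  have h : ∃ (U : Type _) (_ : AddCommGroup U) (_ : Module ℚ U) (_ : FiniteDimensional ℚ U)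
      (μ : Representation ℚ Γ U), ∀ g, μ.character g = σ.character g ^ (j + 1) := by
    induction j with
    | zero => exact ⟨W, inferInstance, inferInstance, inferInstance, σ, fun g => by simp⟩
    | succ j ih =>
      obtain ⟨U, _, _, _, μ, hμ⟩ := ih
      refine ⟨TensorProduct ℚ U W, inferInstance, inferInstance, inferInstance, μ.tprod σ,
        fun g => ?_⟩
      rw [Representation.char_tensor, Pi.mul_apply, hμ, ← pow_succ]
  obtain ⟨U, _, _, _, μ, hμ⟩ := h
  simp only [← hμ]
  exact ⟨_, exists_sum_character_eq μ⟩

variable {Γ : Type*} [Group Γ] (ρ : Γ →* Matrix (Fin 3) (Fin 3) ℚ)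

/-- The action of `Γ` on column vectors. -/
def columnRep : Representation ℚ Γ (Fin 3 → ℚ) :=
  ((Matrix.toLinAlgEquiv' : Matrix (Fin 3) (Fin 3) ℚ ≃ₐ[ℚ] _) :
    Matrix (Fin 3) (Fin 3) ℚ →* _).comp ρ

theorem character_columnRep (g : Γ) : (columnRep ρ).character g = (ρ g).trace :=
  Matrix.trace_toLin'_eq (ρ g)

/-- The fixed space of `ρ g`. -/
def axis (g : Γ) : Submodule ℚ (Fin 3 → ℚ) := LinearMap.eqLocus (columnRep ρ g) LinearMap.id

variable {ρ}

theorem mem_axis {g : Γ} {v : Fin 3 → ℚ} : v ∈ axis ρ g ↔ ρ g *ᵥ v = v := Iff.rfl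

theorem axis_inv (g : Γ) : axis ρ g⁻¹ = axis ρ g := by
  have key : ∀ (g : Γ) v, v ∈ axis ρ g → v ∈ axis ρ g⁻¹ := fun g v hv => by
    rw [mem_axis] at hv ⊢
    conv_lhs => rw [← hv]
    rw [mulVec_mulVec, ← map_mul, inv_mul_cancel, map_one, one_mulVec]
  exact le_antisymm (fun v hv => by simpa using key g⁻¹ v hv) (key g)

theorem two_mul_card_image_axis_le [Fintype Γ] (hdet : ∀ g, (ρ g).det = 1)
    [DecidableEq (Submodule ℚ (Fin 3 → ℚ))] {t : ℚ}
    (h1 : t ≠ -1) (h3 : t ≠ 3) :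
    2 * (({g | (ρ g).trace = t} : Finset Γ).image (axis ρ)).card ≤
      ({g | (ρ g).trace = t} : Finset Γ).card := by
  classical
  refine Finset.mul_card_image_le_card _ 2 fun ℓ hℓ => ?_
  obtain ⟨g, hg, rfl⟩ := Finset.mem_image.mp hℓ
  have hg' : (ρ g).trace = t := by simpa using hg
  have hne : g ≠ g⁻¹ := fun h => by
    have h2 : g * g = 1 := by
      nth_rewrite 2 [h]
      exact mul_inv_cancel g
    rcases trace_eq_of_mul_self_eq_one hdet h2 with h | h
    · exact h1 (hg' ▸ h)
    · exact h3 (hg' ▸ h)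
  rw [← Finset.card_pair hne]
  refine Finset.card_le_card fun x hx => ?_
  rw [Finset.mem_insert, Finset.mem_singleton] at hx
  rcases hx with rfl | rfl
  · simp [hg']
  · simp [trace_map_inv hdet, hg', axis_inv]

/-- A finite group of rotations without nonzero fixed vectors has a conjugation-invariant set of
nontrivial elements, namely those of a given trace, with at most three axes.

Write `c t` for the number of elements of trace `t ∈ {-1, 0, 1, 2}`. Averages of powers of the
character are integers, so `∑ (χ + 1) χ (χ - 1) (χ - 2) = 24` is divisible by the order, which is
`4 + 2 c 1 + c 0 + 3 c 2` because `∑ χ = 0`. An element and its inverse have the same axis, so one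
may assume that `c 0`, `c 1` and `c 2` are zero or at least `8`. Then either `c (-1) = 3`, or the
order is `24` and `∑ χ ^ 2 = 32`, which is not a multiple of `24`. -/
theorem exists_trace_card_image_axis_le [Fintype Γ] (hdet : ∀ g, (ρ g).det = 1)
    (hinj : ∀ g, ρ g = 1 → g = 1) [DecidableEq (Submodule ℚ (Fin 3 → ℚ))]
    (hfix : ∀ v, (∀ g, ρ g *ᵥ v = v) → v = 0) :
    ∃ t : ℚ, t ≠ 3 ∧ (∃ g, (ρ g).trace = t) ∧
      (({g | (ρ g).trace = t} : Finset Γ).image (axis ρ)).card ≤ 3 := by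
  classical
  choose τ hτ hτmem using trace_mem hdet
  set N := Fintype.card Γ with hN
  have hχ : ∀ g, (columnRep ρ).character g = τ g := fun g => by
    rw [character_columnRep, hτ]
  have hsum1 : ∑ g, τ g = 0 := by
    have h := exists_sum_character_eq (columnRep ρ)
    have hinv : (columnRep ρ).invariants = ⊥ := by
      rw [eq_bot_iff]
      intro v hv
      exact hfix v fun g => hv g
    rw [hinv, finrank_bot] at h
    simp only [hχ, Nat.cast_zero, mul_zero] at h
    exact_mod_cast h
  have hsum : ∀ j : ℕ, ∃ d : ℤ, ∑ g, τ g ^ (j + 1) = N * d := fun j => by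
    obtain ⟨d, h⟩ := exists_sum_character_pow_eq (columnRep ρ) j
    simp only [hχ] at h
    exact ⟨d, by exact_mod_cast h⟩
  set c : ℤ → ℕ := fun t => ({g | τ g = t} : Finset Γ).card with hc
  -- Sums over the group, collected by trace; they are used for the exponents `0` to `4`.
  have hfiber : ∀ f : ℤ → ℤ, ∑ g, f (τ g) =
      c (-1) * f (-1) + c 0 * f 0 + c 1 * f 1 + c 2 * f 2 + c 3 * f 3 := by
    intro f
    rw [← Finset.sum_fiberwise_of_maps_to' (t := {-1, 0, 1, 2, 3}) (fun g _ => hτmem g) f]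
    simp [hc]
    ring
  have hc3 : c 3 = 1 := by
    rw [hc]
    simp only
    rw [Finset.card_eq_one]
    refine ⟨1, ?_⟩
    ext g
    simp only [Finset.mem_filter, Finset.mem_univ, true_and, Finset.mem_singleton]
    constructor
    · intro h
      exact hinj g (map_eq_one_of_trace_eq_three hdet (by rw [← hτ, h]; norm_num))
    · rintro rfl
      have := hτ 1
      rw [map_one, trace_one] at this
      exact_mod_cast this
  have e0 := hfiber fun _ => 1
  have e1 := hfiber fun x => x
  have e2 := hfiber fun x => x ^ 2
  have e3 := hfiber fun x => x ^ 3
  have e4 := hfiber fun x => x ^ 4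
  obtain ⟨d2, hd2⟩ := hsum 1
  obtain ⟨d3, hd3⟩ := hsum 2
  obtain ⟨d4, hd4⟩ := hsum 3
  norm_num only at hd2 hd3 hd4
  simp only [hsum1, hd2, hd3, hd4, hc3, Finset.sum_const, Finset.card_univ, nsmul_eq_mul,
    ← hN] at e0 e1 e2 e3 e4
  have hdvd : N ∣ 24 := by
    have : (N : ℤ) ∣ 24 := ⟨d4 - 2 * d3 - d2, by push_cast at *; linarith⟩
    exact_mod_cast this
  have hNle := Nat.le_of_dvd (by norm_num) hdvd
  have hcQ : ∀ t : ℤ, ({g | (ρ g).trace = (t : ℚ)} : Finset Γ).card = c t := fun t => by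
    rw [hc]
    simp only
    congr 1
    ext g
    simp [← hτ]
  have hex : ∀ t : ℤ, c t ≠ 0 → ∃ g, (ρ g).trace = (t : ℚ) := fun t ht => by
    obtain ⟨g, hg⟩ := Finset.card_pos.mp (Nat.pos_of_ne_zero ht)
    exact ⟨g, by rw [← hτ]; simpa using hg⟩
  have hsmall : ∀ t : ℤ, t ≠ -1 → t ≠ 3 → c t ≠ 0 → c t ≤ 7 → ∃ t : ℚ, t ≠ 3 ∧
      (∃ g, (ρ g).trace = t) ∧
      (({g | (ρ g).trace = t} : Finset Γ).image (axis ρ)).card ≤ 3 := by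
    intro t h1 h3 h0 h7
    refine ⟨t, by exact_mod_cast h3, hex t h0, ?_⟩
    have := two_mul_card_image_axis_le hdet (t := t) (by exact_mod_cast h1)
      (by exact_mod_cast h3)
    rw [hcQ] at this
    omega
  by_cases h0 : c 0 ≠ 0 ∧ c 0 ≤ 7
  · exact hsmall 0 (by norm_num) (by norm_num) h0.1 h0.2
  by_cases h1 : c 1 ≠ 0 ∧ c 1 ≤ 7
  · exact hsmall 1 (by norm_num) (by norm_num) h1.1 h1.2
  by_cases h2 : c 2 ≠ 0 ∧ c 2 ≤ 7
  · exact hsmall 2 (by norm_num) (by norm_num) h2.1 h2.2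
  by_cases hm : c (-1) = 3
  · refine ⟨(-1 : ℤ), by norm_num, hex _ (by omega), ?_⟩
    exact Finset.card_image_le.trans (by rw [hcQ, hm])
  exfalso
  have hN24 : N = 24 := by
    obtain ⟨q, hq⟩ := hdvd
    have hN20 : 20 ≤ N := by omega
    have : q = 1 := by
      have : q < 2 := by
        by_contra! hq2
        nlinarith
      interval_cases q
      · omega
      · rfl
    rw [this] at hq
    omega
  rw [hN24] at e2
  push_cast at e2
  omega

end Counting

/-! ### Reducible groups and groups permuting three lines -/

section Dichotomy

open Matrix

theorem eq_one_or_eq_neg_one_of_pow_eq_one {K : Type*} [Field K] [LinearOrder K]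
    [IsStrictOrderedRing K] {c : K} {m : ℕ} (hm : m ≠ 0) (h : c ^ m = 1) : c = 1 ∨ c = -1 := by
  have h1 := congrArg abs h
  rw [abs_pow, abs_one] at h1
  exact eq_or_eq_neg_of_abs_eq ((pow_eq_one_iff_of_nonneg (abs_nonneg c) hm).mp h1)

variable {Γ : Type*} [Group Γ] {ρ : Γ →* Matrix (Fin 3) (Fin 3) ℚ}

theorem map_mulVec_mem_axis {g : Γ} {v : Fin 3 → ℚ} (h : Γ) (hv : v ∈ axis ρ g) :
    ρ h *ᵥ v ∈ axis ρ (h * g * h⁻¹) := by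
  rw [mem_axis] at hv ⊢
  rw [mulVec_mulVec, ← map_mul, inv_mul_cancel_right, map_mul, ← mulVec_mulVec, hv]

theorem map_mulVec_ne_zero (h : Γ) {v : Fin 3 → ℚ} (hv : v ≠ 0) : ρ h *ᵥ v ≠ 0 := by
  intro h0
  apply hv
  have := congrArg (ρ h⁻¹ *ᵥ ·) h0
  simpa [mulVec_mulVec, ← map_mul] using this

theorem exists_axis_eq_span [Fintype Γ] (hdet : ∀ g, (ρ g).det = 1) {g : Γ} (hg : ρ g ≠ 1) :
    ∃ v ≠ 0, axis ρ g = Submodule.span ℚ {v} := by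
  obtain ⟨v, hv0, hv⟩ := exists_mulVec_eq_self hdet g
  refine ⟨v, hv0, le_antisymm (fun w hw => ?_) ?_⟩
  · obtain ⟨c, hc⟩ := exists_smul_of_mulVec_eq_self Fintype.card_ne_zero (map_pow_card_eq_one g)
      (hdet g) hg hv0 hv hw
    exact Submodule.mem_span_singleton.mpr ⟨c, hc.symm⟩
  · rw [Submodule.span_singleton_le_iff_mem]
    exact hv

/-- A nontrivial rotation of finite order whose axis is one of three independent lines permuted by
it is, possibly after squaring, the half-turn about this axis. -/
theorem exists_half_turn [Fintype Γ] (hdet : ∀ g, (ρ g).det = 1) {w : Fin 3 → Fin 3 → ℚ}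
    (hw : LinearIndependent ℚ w) {h : Γ} (hne : ρ h ≠ 1) {π : Equiv.Perm (Fin 3)} {ε : Fin 3 → ℚ}
    (hπ : ∀ i, ρ h *ᵥ w i = ε i • w (π i)) {i : Fin 3} (hi : ρ h *ᵥ w i = w i) :
    ∃ g : Γ, ∀ j, ρ g *ᵥ w j = (if j = i then 1 else -1 : ℚ) • w j := by
  have hm : Fintype.card Γ ≠ 0 := Fintype.card_ne_zero
  have hli := Fintype.linearIndependent_iff.mp hw
  have hax : ∀ u, ρ h *ᵥ u = u → ∃ c : ℚ, u = c • w i := fun u hu =>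
    exists_smul_of_mulVec_eq_self hm (map_pow_card_eq_one h) (hdet h) hne (hw.ne_zero i) hi hu
  have hpm : ∀ (g : Γ) (j : Fin 3) (c : ℚ), ρ g *ᵥ w j = c • w j → c = 1 ∨ c = -1 :=
    fun g j c hc => eq_one_or_eq_neg_one_of_pow_eq_one hm
      (pow_eq_one_of_mulVec_eq (map_pow_card_eq_one g) (hw.ne_zero j) hc)
  have hπi : π i = i := by
    by_contra hne'
    have h1 : ∑ l, (Pi.single i 1 - Pi.single (π i) (ε i) : Fin 3 → ℚ) l • w l = 0 := by
      simp [sub_smul, Pi.single_apply, ← hπ, hi]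
    have := hli _ h1 i
    simp [Ne.symm hne'] at this
  -- Either `h` fixes all three lines and its other eigenvalues are `-1`, or it swaps two of them.
  by_cases hfix : ∀ j, π j = j
  · refine ⟨h, fun j => ?_⟩
    split_ifs with hj
    · rw [hj, hi, one_smul]
    · have h1 := hπ j
      rw [hfix j] at h1
      rcases hpm h j (ε j) h1 with h2 | h2
      · exfalso
        rw [h2, one_smul] at h1
        obtain ⟨c, hc⟩ := hax _ h1
        have h3 : ∑ l, (Pi.single j 1 - Pi.single i c : Fin 3 → ℚ) l • w l = 0 := by
          simp [sub_smul, Pi.single_apply, ← hc]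
        have := hli _ h3 j
        simp [hj] at this
      · rw [h1, h2]
  · push Not at hfix
    obtain ⟨j, hj⟩ := hfix
    set k := π j with hk
    have hji : j ≠ i := fun h => hj (by rw [hk, h, hπi])
    have hki : k ≠ i := fun h => hji (π.injective (by rw [← hk, h, hπi]))
    have hπk : π k = j := by
      have h1 : π k ≠ k := fun h => hj (π.injective h)
      have h2 : π k ≠ i := fun h => hki (π.injective (by rw [h, hπi]))
      omega
    have hhj : ρ (h * h) *ᵥ w j = (ε j * ε k) • w j := by
      rw [map_mul, ← mulVec_mulVec, hπ, mulVec_smul, ← hk, hπ, hπk, smul_smul]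
    have hhk : ρ (h * h) *ᵥ w k = (ε j * ε k) • w k := by
      rw [map_mul, ← mulVec_mulVec, hπ, mulVec_smul, hπk, hπ, ← hk, smul_smul, mul_comm]
    rcases hpm _ _ _ hhj with h1 | h1
    · -- If the square of `h` were trivial, `h` would fix a vector outside its axis.
      exfalso
      obtain ⟨c, hc⟩ := hax (w j + ε j • w k) (by
        rw [mulVec_add, mulVec_smul, hπ, hπ, hπk, smul_smul, h1, one_smul, ← hk, add_comm])
      have h3 : ∑ l, (Pi.single j 1 + Pi.single k (ε j) - Pi.single i c : Fin 3 → ℚ) l • w l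
          = 0 := by
        simp [sub_smul, add_smul, Finset.sum_add_distrib, Pi.single_apply, ← hc]
      have := hli _ h3 j
      simp [hji, Ne.symm hj] at this
    · refine ⟨h * h, fun l => ?_⟩
      split_ifs with hl
      · rw [hl, map_mul, ← mulVec_mulVec, hi, hi, one_smul]
      · have : l = j ∨ l = k := by omega
        rcases this with rfl | rfl
        · rw [hhj, h1]
        · rw [hhk, h1]

/-- A finite rational rotation group is reducible, or it permutes three independent lines and
contains the half-turns about them. -/
theorem exists_invariant_submodule_or_half_turns [Fintype Γ] (hdet : ∀ g, (ρ g).det = 1)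
    (hinj : ∀ g, ρ g = 1 → g = 1) :
    (∃ W : Submodule ℚ (Fin 3 → ℚ), W ≠ ⊥ ∧ W ≠ ⊤ ∧ ∀ g, ∀ v ∈ W, ρ g *ᵥ v ∈ W) ∨
    ∃ w : Fin 3 → Fin 3 → ℚ, LinearIndependent ℚ w ∧
      (∀ g, ∃ π : Equiv.Perm (Fin 3), ∃ ε : Fin 3 → ℚ, ∀ i, ρ g *ᵥ w i = ε i • w (π i)) ∧
      ∀ i, ∃ g, ∀ j, ρ g *ᵥ w j = (if j = i then 1 else -1 : ℚ) • w j := by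
  classical
  rw [or_iff_not_imp_left]
  intro hA
  push Not at hA
  have hirr : ∀ W : Submodule ℚ (Fin 3 → ℚ), W ≠ ⊥ → (∀ g, ∀ v ∈ W, ρ g *ᵥ v ∈ W) → W = ⊤ := by
    intro W h0 hinv
    by_contra h1
    obtain ⟨g, v, hv, hgv⟩ := hA W h0 h1
    exact hgv (hinv g v hv)
  have hfix : ∀ v, (∀ g, ρ g *ᵥ v = v) → v = 0 := by
    intro v hv
    by_contra h0
    have htop := hirr (Submodule.span ℚ {v}) (by simpa using h0) (by
      intro g u hu
      obtain ⟨c, rfl⟩ := Submodule.mem_span_singleton.mp hu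
      rw [mulVec_smul, hv]
      exact hu)
    have h1 := finrank_span_singleton (K := ℚ) h0
    rw [htop, finrank_top] at h1
    simp at h1
  obtain ⟨t, ht3, ⟨g₀, hg₀⟩, hcard⟩ := exists_trace_card_image_axis_le hdet hinj hfix
  set 𝓛 := ({g | (ρ g).trace = t} : Finset Γ).image (axis ρ) with h𝓛
  have hspec : ∀ ℓ : 𝓛, ∃ v : Fin 3 → ℚ, ∃ g : Γ, v ≠ 0 ∧ ρ g ≠ 1 ∧ (ρ g).trace = t ∧
      axis ρ g = ℓ ∧ axis ρ g = Submodule.span ℚ {v} := by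
    rintro ⟨ℓ, hℓ⟩
    obtain ⟨g, hg, rfl⟩ := Finset.mem_image.mp hℓ
    have hgt : (ρ g).trace = t := by simpa using hg
    have hg1 : ρ g ≠ 1 := by
      intro h
      rw [h] at hgt
      simp at hgt
      exact ht3 hgt.symm
    obtain ⟨v, hv0, hv⟩ := exists_axis_eq_span hdet hg1
    exact ⟨v, g, hv0, hg1, hgt, rfl, hv⟩
  -- Each axis `ℓ` is spanned by a vector `u ℓ` and is the fixed space of an element `γ ℓ`.
  choose u γ hu0 hγ1 hγt hγℓ hγu using hspec
  have hperm : ∀ (h : Γ) (ℓ : 𝓛), ∃ (ℓ' : 𝓛) (c : ℚ), ρ h *ᵥ u ℓ = c • u ℓ' := by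
    intro h ℓ
    have hmem : axis ρ (h * γ ℓ * h⁻¹) ∈ 𝓛 := by
      refine Finset.mem_image_of_mem _ ?_
      rw [Finset.mem_filter]
      refine ⟨Finset.mem_univ _, ?_⟩
      rw [map_mul, trace_mul_comm, ← map_mul, ← mul_assoc, inv_mul_cancel, one_mul, hγt]
    have h1 := map_mulVec_mem_axis h
      (show u ℓ ∈ axis ρ (γ ℓ) from hγu ℓ ▸ Submodule.mem_span_singleton_self _)
    have h2 : axis ρ (h * γ ℓ * h⁻¹) = Submodule.span ℚ {u ⟨_, hmem⟩} := by
      rw [← hγu, hγℓ]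
    rw [h2] at h1
    obtain ⟨c, hc⟩ := Submodule.mem_span_singleton.mp h1
    exact ⟨_, c, hc.symm⟩
  have hspan : Submodule.span ℚ (Set.range u) = ⊤ := by
    refine hirr _ ?_ ?_
    · have hmem : axis ρ g₀ ∈ 𝓛 := Finset.mem_image_of_mem _ (by simpa using hg₀)
      intro h0
      exact hu0 ⟨_, hmem⟩ (Submodule.span_eq_bot.mp h0 _ ⟨_, rfl⟩)
    · intro h v hv
      induction hv using Submodule.span_induction with
      | mem v hv =>
        obtain ⟨ℓ, rfl⟩ := hv
        obtain ⟨ℓ', c, hc⟩ := hperm h ℓ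
        rw [hc]
        exact Submodule.smul_mem _ _ (Submodule.subset_span ⟨ℓ', rfl⟩)
      | zero => rw [mulVec_zero]; exact Submodule.zero_mem _
      | add x y _ _ hx hy => rw [mulVec_add]; exact Submodule.add_mem _ hx hy
      | smul c x _ hx => rw [mulVec_smul]; exact Submodule.smul_mem _ _ hx
  have hcard3 : Fintype.card 𝓛 = 3 := by
    refine le_antisymm (by simpa using hcard) ?_
    have h1 := finrank_range_le_card (R := ℚ) u
    rw [Set.finrank, hspan, finrank_top] at h1
    simpa using h1
  have hli : LinearIndependent ℚ u :=
    linearIndependent_of_top_le_span_of_card_eq_finrank hspan.ge (by rw [hcard3]; simp)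
  let e : Fin 3 ≃ 𝓛 := (Fintype.equivFinOfCardEq hcard3).symm
  have hw : LinearIndependent ℚ (u ∘ e) := hli.comp e e.injective
  have hmono : ∀ g, ∃ π : Equiv.Perm (Fin 3), ∃ ε : Fin 3 → ℚ,
      ∀ i, ρ g *ᵥ (u ∘ e) i = ε i • (u ∘ e) (π i) := by
    intro g
    choose p ε hp using fun i => hperm g (e i)
    have hε : ∀ i, ε i ≠ 0 := fun i h0 => by
      have := hp i
      rw [h0, zero_smul] at this
      exact map_mulVec_ne_zero g (hu0 (e i)) this
    have hinj' : Function.Injective fun i => e.symm (p i) := by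
      intro i j hij
      by_contra hne
      have hpij : p i = p j := e.symm.injective hij
      have h0 : ε j • u (e i) - ε i • u (e j) = 0 := by
        by_contra hne0
        refine map_mulVec_ne_zero (ρ := ρ) g hne0 ?_
        rw [mulVec_sub, mulVec_smul, mulVec_smul, hp, hp, hpij, smul_smul, smul_smul, mul_comm,
          sub_self]
      have h1 : ∑ l, (Pi.single i (ε j) - Pi.single j (ε i) : Fin 3 → ℚ) l • (u ∘ e) l = 0 := by
        simpa [sub_smul, Pi.single_apply] using h0
      have := Fintype.linearIndependent_iff.mp hw _ h1 i
      simp [hne] at this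
      exact hε j this
    refine ⟨Equiv.ofBijective _ (Finite.injective_iff_bijective.mp hinj'), ε, fun i => ?_⟩
    simp [hp]
  refine ⟨u ∘ e, hw, hmono, fun i => ?_⟩
  obtain ⟨π, ε, hπ⟩ := hmono (γ (e i))
  exact exists_half_turn hdet hw (hγ1 (e i)) hπ
    (mem_axis.mp (hγu (e i) ▸ Submodule.mem_span_singleton_self _))

/-- An invariant proper nonzero subspace is a plane or a line, and the orthogonal complement of an
invariant line for the invariant form is an invariant plane. -/
theorem exists_invariant_plane [Fintype Γ] {W : Submodule ℚ (Fin 3 → ℚ)} (h0 : W ≠ ⊥) (h1 : W ≠ ⊤)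
    (hW : ∀ g, ∀ v ∈ W, ρ g *ᵥ v ∈ W) :
    ∃ W' : Submodule ℚ (Fin 3 → ℚ), Module.finrank ℚ W' = 2 ∧ ∀ g, ∀ v ∈ W', ρ g *ᵥ v ∈ W' := by
  have hlt := Submodule.finrank_lt h1
  have hpos : Module.finrank ℚ W ≠ 0 := fun h => h0 (Submodule.finrank_eq_zero.mp h)
  rw [Module.finrank_fin_fun] at hlt
  obtain h2 | h2 : Module.finrank ℚ W = 2 ∨ Module.finrank ℚ W = 1 := by omega
  · exact ⟨W, h2, hW⟩
  obtain ⟨⟨w, hwW⟩, hw0, hw⟩ := finrank_eq_one_iff'.mp h2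
  replace hw0 : w ≠ 0 := fun h => hw0 (Subtype.ext h)
  let φ : Module.Dual ℚ (Fin 3 → ℚ) :=
    (dotProductBilin ℚ ℚ w).comp (Matrix.toLin' (invariantForm ρ))
  have hφ : ∀ v, φ v = w ⬝ᵥ (invariantForm ρ *ᵥ v) := fun v => rfl
  have hφ0 : φ ≠ 0 := fun h => dotProduct_invariantForm_self_ne_zero ρ hw0 (by rw [← hφ, h]; rfl)
  refine ⟨LinearMap.ker φ, ?_, fun g v hv => ?_⟩
  · have := Module.Dual.finrank_ker_add_one_of_ne_zero hφ0
    rw [Module.finrank_fin_fun] at this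
    omega
  · rw [LinearMap.mem_ker, hφ] at hv ⊢
    obtain ⟨c, hc⟩ := hw ⟨_, hW g w hwW⟩
    replace hc : c • w = ρ g *ᵥ w := congrArg Subtype.val hc
    have hc0 : c ≠ 0 := by
      rintro rfl
      rw [zero_smul] at hc
      exact map_mulVec_ne_zero g hw0 hc.symm
    rw [← dotProduct_invariantForm_map ρ g, ← hc, smul_dotProduct] at hv
    exact (smul_eq_zero.mp hv).resolve_left hc0

end Dichotomy

/-! ### Linear forms -/

section Linear

open Matrix IntermediateField

variable {k : Type*} [Field k] {n : ℕ}

theorem trdeg_ratFuncField : Algebra.trdeg k (RatFuncField k n) = n := by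
  have : Algebra.IsAlgebraic (MvPolynomial (Fin n) k) (RatFuncField k n) :=
    IsLocalization.isAlgebraic _ (nonZeroDivisors (MvPolynomial (Fin n) k))
  have h := trdeg_add_eq k (MvPolynomial (Fin n) k) (A := RatFuncField k n)
  rw [trdeg_eq_zero (R := MvPolynomial (Fin n) k), MvPolynomial.trdeg_of_isDomain] at h
  simpa using h.symm

variable (k n) in
/-- The linear forms in `k(x₀, …, x_{n-1})`. -/
noncomputable def linearForm : (Fin n → k) →ₗ[k] RatFuncField k n :=
  Fintype.linearCombination k fun i =>
    algebraMap (MvPolynomial (Fin n) k) (RatFuncField k n) (MvPolynomial.X i)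

theorem linearForm_apply (v : Fin n → k) : linearForm k n v = ∑ i, v i •
    algebraMap (MvPolynomial (Fin n) k) (RatFuncField k n) (MvPolynomial.X i) := rfl

theorem linearForm_single (i : Fin n) : linearForm k n (Pi.single i 1) =
    algebraMap (MvPolynomial (Fin n) k) (RatFuncField k n) (MvPolynomial.X i) := by
  simp [linearForm, Fintype.linearCombination_apply_single]

theorem linearAction_linearForm (σ : GeneralLinearGroup (Fin n) k) (v : Fin n → k) :
    linearAction k n σ (linearForm k n v) = linearForm k n (σ.1 *ᵥ v) := by
  simp only [linearForm_apply, map_sum, Algebra.smul_def, map_mul, AlgEquiv.commutes,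
    linearAction_X, mulVec, dotProduct, Finset.mul_sum, Finset.sum_mul]
  rw [Finset.sum_comm]
  refine Finset.sum_congr rfl fun i _ => Finset.sum_congr rfl fun j _ => ?_
  ring

theorem linearForm_ne_zero {v : Fin n → k} (hv : v ≠ 0) : linearForm k n v ≠ 0 := by
  obtain ⟨i, hi⟩ := Function.ne_iff.mp hv
  have h : linearForm k n v = algebraMap (MvPolynomial (Fin n) k) (RatFuncField k n)
      (∑ j, MvPolynomial.C (v j) * MvPolynomial.X j) := by
    simp only [linearForm_apply, map_sum, map_mul, Algebra.smul_def,
      ← MvPolynomial.algebraMap_eq, ← IsScalarTower.algebraMap_apply]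
  rw [h, Ne, map_eq_zero_iff _ (IsFractionRing.injective _ _)]
  intro h0
  apply hi
  have := congrArg (MvPolynomial.eval (Pi.single i 1)) h0
  simpa [Pi.single_apply] using this

theorem adjoin_linearForm_eq_top {s : Set (Fin n → k)} (hs : Submodule.span k s = ⊤) :
    adjoin k (linearForm k n '' s) = ⊤ := by
  set L := adjoin k (linearForm k n '' s) with hL
  have h1 : ∀ v, linearForm k n v ∈ L := by
    intro v
    have hv : v ∈ Submodule.span k s := hs ▸ Submodule.mem_top
    induction hv using Submodule.span_induction with
    | mem v hv => exact subset_adjoin k _ ⟨v, hv, rfl⟩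
    | zero => rw [map_zero]; exact zero_mem _
    | add x y _ _ hx hy => rw [map_add]; exact add_mem hx hy
    | smul c x _ hx => rw [map_smul]; exact IntermediateField.smul_mem _ hx
  have h2 : ∀ p : MvPolynomial (Fin n) k, algebraMap _ (RatFuncField k n) p ∈ L := by
    intro p
    induction p using MvPolynomial.induction_on with
    | C a => exact IntermediateField.algebraMap_mem L a
    | add p q hp hq => rw [map_add]; exact add_mem hp hq
    | mul_X p i hp =>
      rw [map_mul, ← linearForm_single]
      exact mul_mem hp (h1 _)
  rw [eq_top_iff]
  intro x _
  obtain ⟨p, q, -, rfl⟩ := IsFractionRing.div_surjective (A := MvPolynomial (Fin n) k) x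
  exact div_mem (h2 p) (h2 q)

instance (G : Subgroup (GeneralLinearGroup (Fin n) k)) [Finite G] :
    Finite (G.map (linearAction k n)) :=
  ((Set.toFinite (G : Set (GeneralLinearGroup (Fin n) k))).image (linearAction k n)).to_subtype

theorem isRationalOver_linearFixedField_of_plane (G : Subgroup (GeneralLinearGroup (Fin 3) k))
    [Finite G] {W : Submodule k (Fin 3 → k)} (hW : Module.finrank k W = 2)
    (hinv : ∀ σ ∈ G, ∀ v ∈ W, σ.1 *ᵥ v ∈ W) : IsRationalOver (linearFixedField G) := by
  let B := Module.finBasisOfFinrankEq k W hW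
  set a : Fin 3 → k := (B 0).1 with ha
  set b : Fin 3 → k := (B 1).1 with hb
  have hab : ∀ v ∈ W, ∃ α β : k, v = α • a + β • b := by
    intro v hv
    refine ⟨B.repr ⟨v, hv⟩ 0, B.repr ⟨v, hv⟩ 1, ?_⟩
    have := congrArg Subtype.val (B.sum_repr ⟨v, hv⟩)
    rw [Fin.sum_univ_two] at this
    exact this.symm
  have hWtop : W ≠ ⊤ := fun h => by
    rw [h, finrank_top, Module.finrank_fin_fun] at hW
    omega
  obtain ⟨c, -, hc⟩ := SetLike.exists_of_lt (lt_top_iff_ne_top.mpr hWtop)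
  have htop : W ⊔ Submodule.span k {c} = ⊤ := by
    apply Submodule.eq_top_of_finrank_eq
    have h1 : W < W ⊔ Submodule.span k {c} := by
      refine lt_of_le_of_ne le_sup_left fun h => hc ?_
      rw [h]
      exact Submodule.mem_sup_right (Submodule.mem_span_singleton_self c)
    have h2 := Submodule.finrank_lt_finrank_of_lt h1
    have h3 := Submodule.finrank_le (W ⊔ Submodule.span k {c})
    rw [Module.finrank_fin_fun] at h3 ⊢
    omega
  have hspan : Submodule.span k {a, b, c} = ⊤ := by
    rw [eq_top_iff, ← htop, sup_le_iff]
    refine ⟨fun v hv => ?_, Submodule.span_mono (by simp)⟩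
    obtain ⟨α, β, rfl⟩ := hab v hv
    exact Submodule.add_mem _ (Submodule.smul_mem _ _ (Submodule.subset_span (by simp)))
      (Submodule.smul_mem _ _ (Submodule.subset_span (by simp)))
  have hgen := adjoin_linearForm_eq_top hspan
  rw [Set.image_insert_eq, Set.image_pair] at hgen
  have hb0 : b ≠ 0 := fun h => B.ne_zero 1 (Subtype.ext h)
  rw [linearFixedField]
  refine isRationalOver_of_invariant_plane (trdeg_ratFuncField (k := k) (n := 3))
    (G.map (linearAction k 3)) hgen (linearForm_ne_zero hb0) ?_ ?_
  · rintro _ ⟨σ, hσ, rfl⟩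
    obtain ⟨α, β, h1⟩ := hab _ (hinv σ hσ a (B 0).2)
    obtain ⟨γ, δ, h2⟩ := hab _ (hinv σ hσ b (B 1).2)
    refine ⟨α, β, γ, δ, ?_, ?_⟩
    · rw [linearAction_linearForm, h1, map_add, map_smul, map_smul]
    · rw [linearAction_linearForm, h2, map_add, map_smul, map_smul]
  · rintro _ ⟨σ, hσ, rfl⟩
    have : σ.1 *ᵥ c ∈ W ⊔ Submodule.span k {c} := htop ▸ Submodule.mem_top
    obtain ⟨v, hv, u, hu, hvu⟩ := Submodule.mem_sup.mp this
    obtain ⟨α, β, rfl⟩ := hab v hv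
    obtain ⟨χ, rfl⟩ := Submodule.mem_span_singleton.mp hu
    refine ⟨α, β, χ, ?_⟩
    rw [linearAction_linearForm, ← hvu]
    simp only [map_add, map_smul]
    rw [add_comm]

theorem isRationalOver_linearFixedField_of_monomial [CharZero k]
    (G : Subgroup (GeneralLinearGroup (Fin 3) k)) [Finite G] {w : Fin 3 → Fin 3 → k}
    (hw : LinearIndependent k w) (b : Fin 3 → k) (hb : ∀ i, b i ≠ 0)
    (hperm : ∀ σ ∈ G, ∃ π : Equiv.Perm (Fin 3), ∃ ε : Fin 3 → k,
      ∀ i, σ.1 *ᵥ w i = ε i • w (π i) ∧ ε i ^ 2 * b i = b (π i))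
    (hflip : ∀ i, ∃ σ ∈ G, ∃ s : k, s ^ 2 = 1 ∧
      ∀ j, σ.1 *ᵥ w j = (if j = i then s else -s) • w j) :
    IsRationalOver (linearFixedField G) := by
  have hgen := adjoin_linearForm_eq_top (hw.span_eq_top_of_card_eq_finrank (by simp))
  rw [← Set.range_comp] at hgen
  rw [linearFixedField]
  refine isRationalOver_of_monomial (trdeg_ratFuncField (k := k) (n := 3))
    (G.map (linearAction k 3)) (linearForm k 3 ∘ w) hgen b hb ?_ ?_
  · rintro _ ⟨σ, hσ, rfl⟩
    obtain ⟨π, ε, h⟩ := hperm σ hσ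
    have h1 : ∀ i, linearAction k 3 σ (linearForm k 3 (w i)) = ε i • linearForm k 3 (w (π i)) :=
      fun i => by rw [linearAction_linearForm, (h i).1, map_smul]
    refine ⟨π, ε, h1, fun i => ?_⟩
    rw [Algebra.smul_def, map_mul, AlgEquiv.commutes, map_pow, Function.comp_apply, h1, smul_pow,
      ← Algebra.smul_def, smul_smul, mul_comm, (h i).2]
    rfl
  · intro i
    obtain ⟨σ, hσ, s, hs, h⟩ := hflip i
    refine ⟨_, ⟨σ, hσ, rfl⟩, s, hs, fun j => ?_⟩
    rw [Function.comp_apply]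
    exact (linearAction_linearForm σ (w j)).trans (by rw [h j, map_smul])

end Linear

/-! ### Finite subgroups of `GL₃(ℚ)` -/

open Matrix in
theorem theoremA2 (G : Subgroup (Matrix.GeneralLinearGroup (Fin 3) ℚ)) [Finite G] :
    IsRationalOver (linearFixedField G) := by
  classical
  have := Fintype.ofFinite G
  have hdet1 : ∀ g : G, g.1.1.det = 1 ∨ g.1.1.det = -1 := fun g => by
    refine eq_one_or_eq_neg_one_of_pow_eq_one (Fintype.card_ne_zero (α := G)) ?_
    have h : g.1.1 ^ Fintype.card G = 1 := by
      rw [← Units.val_pow_eq_pow_val, ← Subgroup.coe_pow, pow_card_eq_one]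
      rfl
    rw [← det_pow, h, det_one]
  have hdet2 : ∀ g : G, g.1.1.det ^ 2 = 1 := fun g => by
    rcases hdet1 g with h | h <;> rw [h] <;> norm_num
  -- Multiplication by the determinant turns `G` into a group of rotations.
  let τ : G →* GeneralLinearGroup (Fin 3) ℚ :=
    { toFun := fun g => GeneralLinearGroup.det g.1 • g.1
      map_one' := by simp
      map_mul' := fun g h => by
        ext i j
        simp only [Subgroup.coe_mul, map_mul, Units.val_smul, Units.val_mul, smul_mul_assoc,
          mul_smul_comm]
        rw [mul_smul, smul_comm] }
  have := Fintype.ofFinite τ.range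
  let ρ : τ.range →* Matrix (Fin 3) (Fin 3) ℚ := (Units.coeHom _).comp τ.range.subtype
  have hρ : ∀ g : G, ρ ⟨τ g, g, rfl⟩ = g.1.1.det • g.1.1 := fun g => rfl
  have hdet : ∀ γ, (ρ γ).det = 1 := by
    rintro ⟨_, g, rfl⟩
    rw [hρ, det_smul]
    simp
    linear_combination (g.1.1.det ^ 2 + 1) * hdet2 g
  have hinj : ∀ γ, ρ γ = 1 → γ = 1 := fun γ h => Subtype.ext (Units.ext h)
  have hG : ∀ (σ) (hσ : σ ∈ G) (v : Fin 3 → ℚ),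
      σ.1 *ᵥ v = σ.1.det • (ρ ⟨τ ⟨σ, hσ⟩, _, rfl⟩ *ᵥ v) := fun σ hσ v => by
    rw [hρ, smul_mulVec, smul_smul, ← sq, hdet2 ⟨σ, hσ⟩, one_smul]
  rcases exists_invariant_submodule_or_half_turns hdet hinj with
    ⟨W, h0, h1, hW⟩ | ⟨w, hw, hperm, hflip⟩
  · obtain ⟨W', h2, hW'⟩ := exists_invariant_plane h0 h1 hW
    refine isRationalOver_linearFixedField_of_plane G h2 fun σ hσ v hv => ?_
    rw [hG σ hσ]
    exact W'.smul_mem _ (hW' _ v hv)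
  · set q : Fin 3 → ℚ := fun i => w i ⬝ᵥ (invariantForm ρ *ᵥ w i) with hq
    have hq0 : ∀ i, q i ≠ 0 := fun i => dotProduct_invariantForm_self_ne_zero ρ (hw.ne_zero i)
    refine isRationalOver_linearFixedField_of_monomial G hw (fun i => (q i)⁻¹)
      (fun i => inv_ne_zero (hq0 i)) ?_ ?_
    · intro σ hσ
      obtain ⟨π, ε, h⟩ := hperm ⟨τ ⟨σ, hσ⟩, _, rfl⟩
      refine ⟨π, fun i => σ.1.det * ε i, fun i => ⟨?_, ?_⟩⟩
      · rw [hG σ hσ, h, smul_smul]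
      · -- The invariant form determines the square of the coefficient.
        have h1 := dotProduct_invariantForm_map ρ ⟨τ ⟨σ, hσ⟩, _, rfl⟩ (w i) (w i)
        rw [h, mulVec_smul, smul_dotProduct, dotProduct_smul, smul_eq_mul, smul_eq_mul] at h1
        have h2 : ε i ^ 2 * q (π i) = q i := by rw [hq]; linear_combination h1
        have := hq0 i
        have := hq0 (π i)
        have h3 := hdet2 ⟨σ, hσ⟩
        rw [mul_pow, h3]
        field_simp
        linear_combination h2
    · intro i
      obtain ⟨⟨_, g, rfl⟩, h⟩ := hflip i
      refine ⟨g.1, g.2, g.1.1.det, hdet2 g, fun j => ?_⟩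
      rw [hG g.1 g.2, h, smul_smul]
      congr 1
      split_ifs <;> ring
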